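/- Let $f(x)=\sin \pi x$. The parameters are $\eta\in\mathbb C$ with $f(2\eta)\neq 0$ and sequences $z_i,\Lambda_i\in\mathbb C$ ($i\ge 0$); put $\Lambda_{[0,i)}=\Lambda_0+\dots+\Lambda_{i-1}$, $\Lambda_{[0,i]}=\Lambda_{[0,i+1)}$, $p_i=z_i+(1-\Lambda_i)\eta$, $q_i=z_i+(1+\Lambda_i)\eta$. A signature is a finite weakly decreasing sequence of nonnegative integers $\nu=(\nu_1\ge\dots\ge\nu_N)=0^{n_0}1^{n_1}2^{n_2}\cdots$, $\ell(\nu)=N$, $n_{<i}=\sum_{j<i}n_j$. *Functions $B$.* On $V_i=\mathrm{Span}(e_k)_{k\ge0}$ let $$a(\lambda,w)e_k=\tfrac{f(z_i-w+(\Lambda_i+1-2k)\eta)}{f(z_i-w+(\Lambda_i+1)\eta)}\tfrac{f(\lambda+2k\eta)}{f(\lambda)}e_k,\qquad b(\lambda,w)e_k=-\tfrac{f(-\lambda+z_i-w+(\Lambda_i-1-2k)\eta)}{f(z_i-w+(\Lambda_i+1)\eta)}\tfrac{f(2\eta)}{f(\lambda)}e_{k+1},$$ $$c(\lambda,w)e_k=-\tfrac{f(-\lambda-z_i+w+(\Lambda_i+1-2k)\eta)}{f(z_i-w+(\Lambda_i+1)\eta)}\tfrac{f(2(\Lambda_i+1-k)\eta)}{f(\lambda)}\tfrac{f(2k\eta)}{f(2\eta)}e_{k-1},\qquad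 d(\lambda,w)e_k=\tfrac{f(z_i-w+(-\Lambda_i+1+2k)\eta)}{f(z_i-w+(\Lambda_i+1)\eta)}\tfrac{f(\lambda-2(\Lambda_i-k)\eta)}{f(\lambda)}e_k .$$ With $T=\begin{bmatrix}a&b\\c&d\end{bmatrix}$, these operators act on $V_0\otimes\dots\otimes V_m$ through the iterated rule $T(\lambda,w)=T_2(\lambda-2\eta h^{(1)},w)\,T_1(\lambda,w)$, where $h^{(1)}$ is the weight of the first factor after the action and $e_k\in V_i$ has weight $\Lambda_i-2k$. For $E_\mu=e_{m_0}\otimes e_{m_1}\otimes\cdots$, $\mu=0^{m_0}1^{m_1}\cdots$, let $B_{\nu/\mu}(\lambda;u_1,\dots,u_k)$ be the coefficient of $E_\nu$ in $b(\lambda,u_1)b(\lambda+2\eta,u_2)\cdots b(\lambda+2\eta(k-1),u_k)E_\mu$ (computed with $m$ large), $B^{\rm norm}_{\nu/\mu}=\prod_{i=0}^{k-1}f(\lambda+2\eta i)\,B_{\nu/\mu}$, and $B^{\rm norm}_\nu=B^{\rm norm}_{\nu/\varnothing}$. *Functions $D^{\rm norm}$ and $B^{\rm stoch}$.* For $\ell(\nu)=N$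 put $$c_\nu(\lambda)=\frac{f(2\eta)^N}{\pi^N\prod_{i=0}^{N-1}f(\lambda+2\eta i)}\prod_{i\ge0}\prod_{j=0}^{n_i-1}\frac{f(\lambda+2\eta(2n_{<i}+n_i+j-\Lambda_{[0,i]}))\,f(\lambda+2\eta(2n_{<i}+1+j-\Lambda_{[0,i)}))}{f(2\eta(\Lambda_i-j))},$$ $$D^{\rm norm}_\nu(\lambda;\rho)=\mathbf 1_{n_0=0}\,\frac{(-1)^Nf(2\eta)^N}{\pi^N c_\nu(\lambda)}\prod_{i=0}^{N-1}\frac{f(\lambda-2\eta\Lambda_0+2\eta(i+1))}{f(\lambda+2\eta i)},$$ and, for $\kappa,\nu$ with all parts $\ge1$, $$B^{\rm stoch}_{\kappa/\nu}(\lambda;u_1,\dots,u_k)=\frac{(-1)^k}{f(2\eta)^k}\prod_{i=1}^k\frac{f(u_i-q_0)}{f(u_i-p_0)}\cdot\frac{D^{\rm norm}_\kappa(\lambda;\rho)}{D^{\rm norm}_\nu(\lambda+2\eta k;\rho)}\,B^{\rm norm}_{\kappa/\nu}(\lambda;u_1,\dots,u_k).$$ *Admissibility.* The parameters are admissible for $M$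 if there are a strip $\{x\le\operatorname{Re}w<x+1\}$ containing all $p_i$ and $q_i$ and simple closed contours $\gamma_1,\dots,\gamma_M$ in it such that $\gamma_M$ includes all $p_i$, $\gamma_j$ includes $\gamma_{j+1}+2\eta$ for $1\le j<M$, and no $q_i$ lies on or inside any $\gamma_j$. **Statement.** Let $L\ge1$, $a>0$, $d>0$. There is $\delta>0$, depending only on $L,a,d$, such that the following holds for all admissible (for $M=L$) parameters and all $\lambda\in\mathbb C$ with $f(2\eta)\ne0$, with $|f(q_i-p_i)|\ge d$ for all $i$, and with, for some $c>0$, $$|f(\lambda+2\eta(m-\Lambda_{[0,i)}))|\ge c\,a^i\qquad\text{for all } i\ge0,\ 0\le m\le 2L .$$ 1. If $u_1,\dots,u_L\in\mathbb C$ satisfy $|u_j-p_i|<\delta$ for all $i,j$, then, with absolute convergence, the sum being over all signatures, $$\sum_\kappa D^{\rm norm}_\kappa(\lambda;\rho)\,B^{\rm norm}_\kappa(\lambda;u_1,\dots,u_L)=(-f(2\eta))^L\prod_{i=1}^L\frac{f(u_i-p_0)}{f(u_i-q_0)} .$$ 2. If $k\ge1$, $\nu$ is a signature with all parts $\ge1$,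 $\ell(\nu)+k=L$, and $u_1,\dots,u_k\in\mathbb C$ satisfy $|u_j-p_i|<\delta$ and $f(u_j-p_0)\neq0$ for all $i,j$, then, with absolute convergence, the sum being over all signatures with all parts $\ge1$, $$\sum_\kappa B^{\rm stoch}_{\kappa/\nu}(\lambda;u_1,\dots,u_k)=1 .$$ -/

import Mathlib

open scoped BigOperators

noncomputable section

namespace TrigIRF

/-- The trigonometric function `f(x) = sin (π x)`. -/
def f (x : ℂ) : ℂ := Complex.sin ((Real.pi : ℂ) * x)

/-- The parameters: `η`, and, for every column `i ≥ 0`, the inhomogeneity `z i` and the highest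
weight `Λ i` of the evaluation Verma module `V_{Λ i}(z i)` with basis `e_0, e_1, …`. -/
structure Params where
  η : ℂ
  z : ℕ → ℂ
  Λ : ℕ → ℂ

/-- A signature `ν = (ν₁ ≥ … ≥ ν_N ≥ 0)`, written multiplicatively as `0^{ν 0} 1^{ν 1} 2^{ν 2} ⋯`:
`ν i` is the number of parts equal to `i`, and the length `N` is `Finsupp.degree ν = ∑ i, ν i`.
The same data index the finitary basis vectors `E_ν = e_{ν 0} ⊗ e_{ν 1} ⊗ ⋯`. -/
abbrev Signature := ℕ →₀ ℕ

/-- The number of parts. -/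
def len (ν : Signature) : ℕ := Finsupp.degree ν

/-- The number of parts smaller than `i`. -/
def numLT (ν : Signature) (i : ℕ) : ℕ := ∑ j ∈ Finset.range i, ν j

namespace Params

/-- `Λ_{[0,i)} = Λ_0 + ⋯ + Λ_{i-1}`. -/
def sumΛ (P : Params) (i : ℕ) : ℂ := ∑ j ∈ Finset.range i, P.Λ j

/-- `p_i = z_i + (1 - Λ_i) η`. -/
def p (P : Params) (i : ℕ) : ℂ := P.z i + (1 - P.Λ i) * P.η

/-- `q_i = z_i + (1 + Λ_i) η`. -/
def q (P : Params) (i : ℕ) : ℂ := P.z i + (1 + P.Λ i) * P.η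

end Params

/-! ### The operators `a, b, c, d` and the functions `B` -/

/-- Coefficients of `e_l` in the action on `e_k`, arranged as the matrix `[[a, b], [c, d]]`, of the
operators `a(lam,w), b(lam,w), c(lam,w), d(lam,w)` on the evaluation Verma module in column `i`. -/
def localOp (P : Params) (i : ℕ) (lam w : ℂ) (k l : ℕ) : Matrix (Fin 2) (Fin 2) ℂ :=
  !![if l = k then
        f (P.z i - w + (P.Λ i + 1 - 2 * k) * P.η) / f (P.z i - w + (P.Λ i + 1) * P.η)
          * (f (lam + 2 * k * P.η) / f lam)
      else 0,
     if l = k + 1 then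
        -(f (-lam + P.z i - w + (P.Λ i - 1 - 2 * k) * P.η) / f (P.z i - w + (P.Λ i + 1) * P.η))
          * (f (2 * P.η) / f lam)
      else 0;
     if l + 1 = k then
        -(f (-lam - P.z i + w + (P.Λ i + 1 - 2 * k) * P.η) / f (P.z i - w + (P.Λ i + 1) * P.η))
          * (f (2 * (P.Λ i + 1 - k) * P.η) / f lam) * (f (2 * k * P.η) / f (2 * P.η))
      else 0,
     if l = k then
        f (P.z i - w + (-P.Λ i + 1 + 2 * k) * P.η) / f (P.z i - w + (P.Λ i + 1) * P.η)
          * (f (lam - 2 * (P.Λ i - k) * P.η) / f lam)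
      else 0]

/-- Coefficients of `e_{ν 0} ⊗ ⋯ ⊗ e_{ν (n-1)}` in the action of `a, b, c, d` on
`e_{μ 0} ⊗ ⋯ ⊗ e_{μ (n-1)}` in `V_0 ⊗ ⋯ ⊗ V_{n-1}`. The tensor product rule is
`T(lam) = T₂(lam - 2 η h) T₁(lam)`, a product of `2 × 2` matrices, where `h` is the weight of the
first factor after the action; the weight of `e_k` in column `i` is `Λ_i - 2 k`. -/
def tensorOp (P : Params) (lam w : ℂ) (μ ν : Signature) : ℕ → Matrix (Fin 2) (Fin 2) ℂ
  | 0 => 1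
  | n + 1 =>
      localOp P n (lam - 2 * P.η * ∑ i ∈ Finset.range n, (P.Λ i - 2 * (ν i : ℂ))) w (μ n) (ν n)
        * tensorOp P lam w μ ν n

/-- `B_{ν/μ}(lam; w)`, the coefficient of `E_ν` in `b(lam,w) E_μ`, computed in the tensor product of
the columns `0, …, m` with `m` the largest part of `μ` and `ν` (further columns contribute the
factor `1`, because `a(lam,w) e_0 = e_0`). -/
def Bone (P : Params) (ν μ : Signature) (lam w : ℂ) : ℂ :=
  tensorOp P lam w μ ν ((μ.support ∪ ν.support).sup id + 1) 0 1

/-- `B_{ν/μ}(lam; u_1, …, u_k)`, the coefficient of `E_ν` in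
`b(lam,u_1) b(lam+2η,u_2) ⋯ b(lam+2η(k-1),u_k) E_μ`. For fixed `ν` only finitely many intermediate
signatures contribute. -/
def B (P : Params) : (k : ℕ) → (ν μ : Signature) → (lam : ℂ) → (Fin k → ℂ) → ℂ
  | 0, ν, μ, _, _ => if ν = μ then 1 else 0
  | k + 1, ν, μ, lam, u =>
      ∑ᶠ κ : Signature, Bone P ν κ lam (u 0) * B P k κ μ (lam + 2 * P.η) (fun j => u j.succ)

/-- `B^norm_{ν/μ} = ∏_{i<k} f(lam + 2 η i) · B_{ν/μ}`. -/
def Bnorm (P : Params) {k : ℕ} (ν μ : Signature) (lam : ℂ) (u : Fin k → ℂ) : ℂ :=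
  (∏ i ∈ Finset.range k, f (lam + 2 * P.η * i)) * B P k ν μ lam u

/-! ### The specialization `ρ` and the functions `B^stoch` -/

/-- The squared norms `c_ν(lam)`; here `π = f'(0)`. -/
def cNorm (P : Params) (ν : Signature) (lam : ℂ) : ℂ :=
  f (2 * P.η) ^ len ν
    / ((Real.pi : ℂ) ^ len ν * ∏ i ∈ Finset.range (len ν), f (lam + 2 * P.η * i))
  * ∏ i ∈ ν.support, ∏ j ∈ Finset.range (ν i),
      f (lam + 2 * P.η * (2 * numLT ν i + ν i + j - P.sumΛ (i + 1)))
        * f (lam + 2 * P.η * (2 * numLT ν i + 1 + j - P.sumΛ i))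
        / f (2 * P.η * (P.Λ i - j))

/-- `D^norm_ν(lam; ρ)`. It vanishes if `ν` has a zero part, and equals `1` for `ν = ∅`. -/
def Drho (P : Params) (ν : Signature) (lam : ℂ) : ℂ :=
  if ν 0 = 0 then
    (-1) ^ len ν * f (2 * P.η) ^ len ν / ((Real.pi : ℂ) ^ len ν * cNorm P ν lam)
      * ∏ i ∈ Finset.range (len ν),
          f (lam - 2 * P.η * P.Λ 0 + 2 * P.η * (i + 1)) / f (lam + 2 * P.η * i)
  else 0

/-- `B^stoch_{κ/ν}(lam; u_1, …, u_k)`, for signatures `κ`, `ν` without zero parts. -/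
def Bstoch (P : Params) {k : ℕ} (κ ν : Signature) (lam : ℂ) (u : Fin k → ℂ) : ℂ :=
  (-1) ^ k / f (2 * P.η) ^ k * (∏ i, f (u i - P.q 0) / f (u i - P.p 0))
    * (Drho P κ lam / Drho P ν (lam + 2 * P.η * k)) * Bnorm P κ ν lam u

/-! ### Conditions on the parameters -/

/-- The points included in (that is, lying inside) a closed contour: those off the contour whose
connected component in its complement is bounded. -/
def inside (γ : Circle → ℂ) : Set ℂ :=
  {w | w ∉ Set.range γ ∧ Bornology.IsBounded (connectedComponentIn (Set.range γ)ᶜ w)}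

/-- Admissible parameters, for nested contours `γ_1, …, γ_M` (here numbered `γ 0, …, γ (M-1)`)
in a fundamental strip of `ℂ/ℤ`: all `p_i`, `q_i` lie in the strip, `γ_M` includes all `p_i`,
`γ_j` includes the image of `γ_{j+1}` under `w ↦ w + 2η`, and no `q_i` lies on or inside any of the
contours. A contour is a Jordan curve; its orientation plays no role here. -/
def Admissible (P : Params) (M : ℕ) : Prop :=
  ∃ (x : ℝ) (γ : Fin M → Circle → ℂ),
    (∀ i, P.p i ∈ {w : ℂ | x ≤ w.re ∧ w.re < x + 1}) ∧
    (∀ i, P.q i ∈ {w : ℂ | x ≤ w.re ∧ w.re < x + 1}) ∧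
    (∀ j, Continuous (γ j) ∧ Function.Injective (γ j)) ∧
    (∀ j t, γ j t ∈ {w : ℂ | x ≤ w.re ∧ w.re < x + 1}) ∧
    (∀ j : Fin M, (j : ℕ) + 1 = M → ∀ i, P.p i ∈ inside (γ j)) ∧
    (∀ j j' : Fin M, (j' : ℕ) = j + 1 → ∀ t, γ j' t + 2 * P.η ∈ inside (γ j)) ∧
    (∀ j i, P.q i ∉ inside (γ j) ∧ P.q i ∉ Set.range (γ j))

/-- The dynamic denominators that occur for signatures with at most `L` parts do not vanish, and
decay at most exponentially, at rate `a`, along the columns. -/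
def NonResonant (P : Params) (L : ℕ) (a : ℝ) (lam : ℂ) : Prop :=
  ∃ c : ℝ, 0 < c ∧ ∀ m : ℕ, m ≤ 2 * L → ∀ i : ℕ,
    c * a ^ i ≤ ‖f (lam + 2 * P.η * (m - P.sumΛ i))‖

end TrigIRF

end

open TrigIRF

open scoped BigOperators

noncomputable section

namespace TrigIRF

/-! ### The function `f` -/

/-! A single operator `b`, restricted to targets without zero parts and conjugated by `Drho` (with
the dynamic parameter shifted by `2η` at the source), becomes a two-state chain running along the
columns. The states record whether a path crosses the current edge. The column factors of the
squared norms turn the four local entries into `A`, `1 - A`, `D`, `1 - D`; that the outgoing weights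
sum to one is the three-term relation for `f` (`one_sub_weightA`, `one_sub_weightD`,
`tensorOp_eq_chain`). Since column 0 must stay empty, the path crosses it, so the chain starts with
a path.

The total complex mass after `n` columns is therefore exactly 1 (`sum_box_chain`), and the one-step
identity holds as soon as the mass still carrying a path tends to 0. Crossing an empty column costs
a factor `ε`, because `f (u - p_i)` is small when `u` is close to all `p_i`. The dynamic
denominators contribute ratios that telescope over empty columns and leave one factor growing like
`A ^ n`; occupied columns are controlled by length and weight (`chain_bound`). For small `ε` this
beats both `A ^ n` and the number `(N + 2) ^ n` of configurations.

For several rows, `Bstoch` is a composition of one-step weights (`hasSum_Bstoch_succ`). Bounds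
geometric in the weight of the target justify exchanging the sums, and induction gives part 2. Part
1 is the case of empty `ν` with the prefactor moved across; when some `f (u_j - p_0)` vanishes, both
sides are 0.

Admissibility enters only through `Admissible.f_ne_zero`. The constant `c` of the nonresonance
condition affects only multiplicative constants, so `ε` depends on `L` and `a`, and the radius on
`ε` and `d`. -/

theorem f_zero : f 0 = 0 := by simp [f]

theorem f_neg (x : ℂ) : f (-x) = -f x := by simp [f]

theorem continuous_f : Continuous f := by unfold f; fun_prop

/-- The three-term relation in its trigonometric form. -/
theorem f_mul_sub_f_mul (x y t : ℂ) :
    f (x + t) * f (y + t) - f x * f y = f t * f (x + y + t) := by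
  simp only [f, mul_add, Complex.sin_add, Complex.cos_add]
  have h1 := Complex.sin_sq_add_cos_sq (Real.pi * x)
  have h2 := Complex.sin_sq_add_cos_sq (Real.pi * y)
  have h3 := Complex.sin_sq_add_cos_sq (Real.pi * t)
  linear_combination (Complex.sin (Real.pi * x) * Complex.sin (Real.pi * y)) * h3

theorem exists_int_eq_of_f_eq_zero {x : ℂ} (hx : f x = 0) : ∃ m : ℤ, x = m := by
  obtain ⟨m, hm⟩ := Complex.sin_eq_zero_iff.1 hx
  refine ⟨m, ?_⟩
  have : (Real.pi : ℂ) ≠ 0 := by exact_mod_cast Real.pi_ne_zero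
  apply mul_left_cancel₀ this
  rw [hm]; ring

/-- The exponential size of `f`. -/
def growth (x : ℂ) : ℝ := Real.exp (Real.pi * |x.im|)

theorem growth_pos (x : ℂ) : 0 < growth x := Real.exp_pos _

theorem one_le_growth (x : ℂ) : 1 ≤ growth x := Real.one_le_exp (by positivity)

theorem growth_neg (x : ℂ) : growth (-x) = growth x := by simp [growth]

theorem growth_add_le (x y : ℂ) : growth (x + y) ≤ growth x * growth y := by
  unfold growth
  rw [← Real.exp_add, ← mul_add, Complex.add_im]
  gcongr
  exact abs_add_le _ _

theorem growth_nsmul_le (n : ℕ) (x : ℂ) : growth (n * x) ≤ growth x ^ n := by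
  unfold growth
  rw [← Real.exp_nat_mul]
  simp [abs_mul]
  apply le_of_eq; ring

theorem norm_exp_mul_I_le (z : ℂ) : ‖Complex.exp (z * Complex.I)‖ ≤ Real.exp |z.im| := by
  rw [Complex.norm_exp]
  simp
  exact neg_le_abs _

theorem norm_sin_le_exp (z : ℂ) : ‖Complex.sin z‖ ≤ Real.exp |z.im| := by
  rw [Complex.sin]
  have h1 := norm_exp_mul_I_le z
  have h2 := norm_exp_mul_I_le (-z)
  simp only [Complex.neg_im, abs_neg] at h2
  rw [norm_div, norm_mul, Complex.norm_I, mul_one]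
  have := norm_sub_le (Complex.exp (-z * Complex.I)) (Complex.exp (z * Complex.I))
  simp only [RCLike.norm_ofNat]
  linarith

theorem norm_cos_le_exp (z : ℂ) : ‖Complex.cos z‖ ≤ Real.exp |z.im| := by
  rw [Complex.cos]
  have h1 := norm_exp_mul_I_le z
  have h2 := norm_exp_mul_I_le (-z)
  simp only [Complex.neg_im, abs_neg] at h2
  rw [norm_div]
  have := norm_add_le (Complex.exp (z * Complex.I)) (Complex.exp (-z * Complex.I))
  simp only [RCLike.norm_ofNat]
  linarith

theorem exp_abs_im_le (z : ℂ) : Real.exp |z.im| ≤ 2 * ‖Complex.sin z‖ + 1 := by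
  rw [Complex.sin, norm_div, norm_mul, Complex.norm_I, mul_one]
  simp only [RCLike.norm_ofNat]
  have h1 := norm_sub_norm_le (Complex.exp (-z * Complex.I)) (Complex.exp (z * Complex.I))
  have h2 := norm_sub_norm_le (Complex.exp (z * Complex.I)) (Complex.exp (-z * Complex.I))
  rw [norm_sub_rev] at h2
  have e1 : ‖Complex.exp (z * Complex.I)‖ = Real.exp (-z.im) := by
    rw [Complex.norm_exp]; simp
  have e2 : ‖Complex.exp (-z * Complex.I)‖ = Real.exp (z.im) := by
    rw [Complex.norm_exp]; simp
  rw [e1, e2] at h1 h2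
  rcases le_total 0 z.im with h | h
  · rw [abs_of_nonneg h]
    have : Real.exp (-z.im) ≤ 1 := Real.exp_le_one_iff.2 (by linarith)
    linarith
  · rw [abs_of_nonpos h]
    have : Real.exp (z.im) ≤ 1 := Real.exp_le_one_iff.2 (by linarith)
    linarith

theorem abs_pi_mul_im (x : ℂ) : |((Real.pi : ℂ) * x).im| = Real.pi * |x.im| := by
  simp [abs_mul, abs_of_pos Real.pi_pos]

theorem norm_f_le_growth (x : ℂ) : ‖f x‖ ≤ growth x := by
  have := norm_sin_le_exp (Real.pi * x)
  rwa [abs_pi_mul_im] at this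

theorem norm_cos_le_growth (x : ℂ) : ‖Complex.cos (Real.pi * x)‖ ≤ growth x := by
  have := norm_cos_le_exp (Real.pi * x)
  rwa [abs_pi_mul_im] at this

theorem growth_le (x : ℂ) : growth x ≤ 2 * ‖f x‖ + 1 := by
  have := exp_abs_im_le (Real.pi * x)
  rwa [abs_pi_mul_im] at this

theorem growth_le_mul_of_le {d : ℝ} (hd : 0 < d) {x : ℂ} (hx : d ≤ ‖f x‖) :
    growth x ≤ (2 + 1 / d) * ‖f x‖ := by
  have h1 := growth_le x
  have h2 : 1 ≤ 1 / d * ‖f x‖ := by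
    rw [one_div, inv_mul_eq_div, le_div_iff₀ hd]; linarith
  linarith

/-- Near `x = 0`, `f (y + x)` is comparable to the size of `y`, uniformly over the `y` with `f y`
bounded away from `0`, and `f x` is small. -/
theorem exists_small_radius {d ε : ℝ} (hd : 0 < d) (hε : 0 < ε) :
    ∃ δ > 0, ∃ θ > 0, ∀ x y : ℂ, ‖x‖ < δ → d ≤ ‖f y‖ →
      θ * growth y ≤ ‖f (y + x)‖ ∧ ‖f x‖ * growth y ≤ ε * ‖f (y + x)‖ ∧
        growth x ≤ 2 := by
  -- Since `growth y ≤ (2 + 1/d) ‖f y‖`, this `θ` makes half of `‖f y‖` at least `2θ · growth y`.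
  -- The addition formula loses at most `θ · growth y`, so one `θ · growth y` survives.
  set θ : ℝ := 1 / (4 * (2 + 1 / d)) with hθ
  have hθ0 : 0 < θ := by positivity
  set e : ℝ := min θ (ε * θ)
  have he : 0 < e := by positivity
  have c1 : ∀ᶠ x in nhds (0 : ℂ), ‖f x‖ < e := by
    have : Continuous fun x => ‖f x‖ := continuous_f.norm
    exact (this.tendsto 0).eventually_lt_const (by simpa [f_zero] using he)
  have c2 : ∀ᶠ x in nhds (0 : ℂ), 1 / 2 < ‖Complex.cos (Real.pi * x)‖ := by
    have : Continuous fun x : ℂ => ‖Complex.cos (Real.pi * x)‖ := by fun_prop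
    exact (this.tendsto 0).eventually_const_lt (by simp; norm_num)
  have c3 : ∀ᶠ x in nhds (0 : ℂ), growth x < 2 := by
    have : Continuous growth := by unfold growth; fun_prop
    exact (this.tendsto 0).eventually_lt_const (by simp [growth])
  obtain ⟨δ, hδ, h⟩ := Metric.eventually_nhds_iff.1 (c1.and (c2.and c3))
  refine ⟨δ, hδ, θ, hθ0, fun x y hx hy => ?_⟩
  obtain ⟨h1, h2, h3⟩ := h (y := x) (by simpa using hx)
  have hg := growth_le_mul_of_le hd hy
  have hadd : f (y + x) = f y * Complex.cos (Real.pi * x) + Complex.cos (Real.pi * y) * f x := by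
    simp only [f, mul_add, Complex.sin_add]
  have key : ‖f y‖ * ‖Complex.cos (Real.pi * x)‖ ≤
      ‖f (y + x)‖ + ‖Complex.cos (Real.pi * y)‖ * ‖f x‖ := by
    rw [← norm_mul, ← norm_mul]
    calc _ = ‖f (y + x) - Complex.cos (Real.pi * y) * f x‖ := by rw [hadd]; congr 1; ring
      _ ≤ _ := norm_sub_le _ _
  have k1 : ‖f y‖ * (1 / 2) ≤ ‖f y‖ * ‖Complex.cos (Real.pi * x)‖ := by gcongr
  have k2 : ‖Complex.cos (Real.pi * y)‖ * ‖f x‖ ≤ growth y * θ :=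
    mul_le_mul (norm_cos_le_growth y) (h1.le.trans (min_le_left _ _)) (norm_nonneg _)
      (growth_pos _).le
  have k3 : 2 * θ * growth y ≤ ‖f y‖ * (1 / 2) := by
    have : 2 * θ * ((2 + 1 / d) * ‖f y‖) = ‖f y‖ * (1 / 2) := by
      rw [hθ]; field_simp; norm_num
    rw [← this]; gcongr
  have main : θ * growth y ≤ ‖f (y + x)‖ := by linarith
  refine ⟨main, ?_, h3.le⟩
  calc ‖f x‖ * growth y ≤ (ε * θ) * growth y := by
        gcongr
        · exact (growth_pos _).le
        · exact h1.le.trans (min_le_right _ _)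
    _ = ε * (θ * growth y) := by ring
    _ ≤ _ := by gcongr

/-! ### Nested contours -/

theorem isBounded_of_mem_inside {γ : Circle → ℂ} {w : ℂ} (hw : w ∈ inside γ) {S : Set ℂ}
    (hS : IsPreconnected S) (hwS : w ∈ S) (hd : ∀ y ∈ S, y ∉ Set.range γ) :
    Bornology.IsBounded S :=
  hw.2.subset (hS.subset_connectedComponentIn hwS hd)

theorem not_isBounded_of_ray {S : Set ℂ} {b s : ℝ} (hs : s ≠ 0)
    (h : ∀ r : ℝ, b < s * r → (r : ℂ) ∈ S) : ¬ Bornology.IsBounded S := by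
  intro hS
  obtain ⟨R, hR⟩ := hS.exists_norm_le
  have := hR _ (h ((|b| + |s| * |R| + 1) / s) (by
    rw [mul_div_cancel₀ _ hs]
    have := le_abs_self b
    have := mul_nonneg (abs_nonneg s) (abs_nonneg R)
    linarith))
  rw [Complex.norm_real, Real.norm_eq_abs, abs_div, div_le_iff₀ (abs_pos.2 hs)] at this
  have h1 := le_abs_self (|b| + |s| * |R| + 1)
  have h2 := mul_le_mul_of_nonneg_right (le_abs_self R) (abs_nonneg s)
  have h3 := abs_nonneg b
  nlinarith

theorem re_bounds_of_mem_inside {γ : Circle → ℂ} {x y : ℝ}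
    (hγ : ∀ t, x ≤ (γ t).re ∧ (γ t).re < y) {w : ℂ} (hw : w ∈ inside γ) :
    x ≤ w.re ∧ w.re < y := by
  constructor
  · by_contra! h
    have hc : Convex ℝ {z : ℂ | z.re < x} := convex_halfSpace_re_lt x
    refine not_isBounded_of_ray (S := {z : ℂ | z.re < x}) (b := -x) (s := -1) (by norm_num)
      (fun r hr => by simp only [Set.mem_ofPred_eq, Complex.ofReal_re]; linarith)
      (isBounded_of_mem_inside hw hc.isPreconnected h ?_)
    rintro _ hz ⟨t, rfl⟩
    exact absurd (hγ t).1 (not_le.2 hz)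
  · by_contra! h
    have hc : Convex ℝ {z : ℂ | y ≤ z.re} := convex_halfSpace_re_ge y
    refine not_isBounded_of_ray (S := {z : ℂ | y ≤ z.re}) (b := y) (s := 1) (by norm_num)
      (fun r hr => by simp only [Set.mem_ofPred_eq, Complex.ofReal_re]; linarith)
      (isBounded_of_mem_inside hw hc.isPreconnected h ?_)
    rintro _ hz ⟨t, rfl⟩
    exact absurd (hγ t).2 (not_lt.2 hz)

/-- If a translate of the contour `γ'` lies inside `γ`, so does the translate of its inside. -/
theorem add_mem_inside {γ γ' : Circle → ℂ} (hγ : Continuous γ) {v : ℂ}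
    (hsub : ∀ t, γ' t + v ∈ inside γ) {w : ℂ} (hw : w ∈ inside γ') : w + v ∈ inside γ := by
  have key : ∀ S : Set ℂ, IsPreconnected S → w + v ∈ S → (∀ t, γ' t + v ∉ S) →
      Bornology.IsBounded S := by
    intro S hS hwS hd
    have h1 : Bornology.IsBounded ((fun z => z + -v) '' S) := by
      refine isBounded_of_mem_inside hw (hS.image _ (by fun_prop)) ⟨_, hwS, by simp⟩ ?_
      rintro _ ⟨z, hz, rfl⟩ ⟨t, ht⟩
      apply hd t
      rw [ht]; simpa using hz
    obtain ⟨R, hR⟩ := h1.exists_norm_le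
    refine (isBounded_iff_forall_norm_le).2 ⟨R + ‖v‖, fun z hz => ?_⟩
    have := hR _ ⟨z, hz, rfl⟩
    calc ‖z‖ = ‖(z + -v) + v‖ := by congr 1; ring
      _ ≤ _ := (norm_add_le _ _).trans (by gcongr)
  -- By `key`, a connected unbounded set through `w + v` must meet the translate of `γ'`. No
  -- separation property of Jordan curves is needed.
  by_cases hwγ : w + v ∈ Set.range γ
  · exfalso
    have hcomp : IsCompact (Set.range γ) := isCompact_range hγ
    obtain ⟨k, hk, hmax⟩ := hcomp.exists_isMaxOn (Set.range_nonempty _)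
      Complex.continuous_re.continuousOn
    have hray : IsPreconnected ({z : ℂ | k.re < z.re}) :=
      (convex_halfSpace_re_gt k.re).isPreconnected
    have hunb : ¬ Bornology.IsBounded {z : ℂ | k.re < z.re} :=
      not_isBounded_of_ray (b := k.re) (s := 1) (by norm_num)
        (fun r hr => by simp only [Set.mem_ofPred_eq, Complex.ofReal_re]; linarith)
    have hH : Convex ℝ ({z : ℂ | k.re < z.re} ∪ {k}) := by
      intro z hz y hy α β hα hβ hαβ
      simp only [Set.union_singleton, Set.mem_insert_iff, Set.mem_ofPred_eq] at hz hy ⊢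
      by_cases hα0 : α = 0
      · subst hα0; simp at hαβ; subst hαβ; simpa using hy
      by_cases hβ0 : β = 0
      · subst hβ0; simp at hαβ; subst hαβ; simpa using hz
      have hα' : 0 < α := lt_of_le_of_ne hα (Ne.symm hα0)
      have hβ' : 0 < β := lt_of_le_of_ne hβ (Ne.symm hβ0)
      rcases hz with rfl | hz
      · rcases hy with rfl | hy
        · left; rw [← add_smul, hαβ, one_smul]
        · right; simp only [Complex.add_re, Complex.real_smul, Complex.mul_re, Complex.ofReal_re,
            Complex.ofReal_im, zero_mul, sub_zero]
          have hα2 : α = 1 - β := by linarith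
          subst hα2
          nlinarith [mul_lt_mul_of_pos_left hy hβ']
      · right
        have hy' : k.re ≤ y.re := by rcases hy with rfl | hy <;> linarith
        simp only [Complex.add_re, Complex.real_smul, Complex.mul_re, Complex.ofReal_re,
            Complex.ofReal_im, zero_mul, sub_zero]
        have hβ2 : β = 1 - α := by linarith
        subst hβ2
        nlinarith [mul_lt_mul_of_pos_left hz hα', mul_le_mul_of_nonneg_left hy' hβ]
    -- The contour is joined to the half-plane on its right through a rightmost point `k`. The union
    -- is unbounded but misses the translate of `γ'`, whose points are neither on `γ` nor in its
    -- exterior.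
    have hconn : IsPreconnected (Set.range γ ∪ ({z : ℂ | k.re < z.re} ∪ {k})) :=
      IsPreconnected.union k hk (by simp) (isPreconnected_range hγ) hH.isPreconnected
    refine hunb ((key _ hconn (Or.inl hwγ) fun t ht => ?_).subset
      (fun z hz => Or.inr (Or.inl hz)))
    have ht' := hsub t
    rcases ht with ht | ht | ht
    · exact ht'.1 ht
    · refine hunb (isBounded_of_mem_inside ht' hray ht fun y hy hyr => ?_)
      exact absurd (isMaxOn_iff.1 hmax y hyr) (not_le.2 hy)
    · rw [Set.mem_singleton_iff] at ht
      exact ht'.1 (ht ▸ hk)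
  · refine ⟨hwγ, ?_⟩
    by_contra hbd
    -- If the component of `w + v` were unbounded, it would contain a point of the translated
    -- contour; that point lies inside `γ`, so the same component is bounded.
    refine hbd (key _ isPreconnected_connectedComponentIn (mem_connectedComponentIn hwγ)
      fun t ht => hbd ?_)
    rw [connectedComponentIn_eq ht]
    exact (hsub t).2

/-- Admissibility keeps the highest weights `Λ_i` away from the integers `0, …, M - 1`. -/
theorem Admissible.f_ne_zero {P : Params} {M : ℕ} (h : Admissible P M) (i : ℕ) {j : ℕ}
    (hj : j < M) : f (2 * P.η * (P.Λ i - j)) ≠ 0 := by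
  obtain ⟨x, γ, -, hq, hγ, hstrip, hp, hnest, hout⟩ := h
  -- Going outwards through the nested contours from the innermost one, each step allows one more
  -- shift by `2η`.
  have hins : ∀ j : ℕ, ∀ hj : j < M,
      P.p i + 2 * P.η * j ∈ inside (γ ⟨M - 1 - j, by omega⟩) := by
    intro j
    induction j with
    | zero =>
      intro hj
      simpa using hp ⟨M - 1 - 0, by omega⟩ (by simp; omega) i
    | succ j ih =>
      intro hj
      have := add_mem_inside (hγ ⟨M - 1 - (j + 1), by omega⟩).1
        (hnest ⟨M - 1 - (j + 1), by omega⟩ ⟨M - 1 - j, by omega⟩ (by simp; omega))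
        (ih (by omega))
      convert this using 1
      push_cast; ring
  intro h0
  obtain ⟨m, hm⟩ := exists_int_eq_of_f_eq_zero h0
  have hin := hins j hj
  have hre := re_bounds_of_mem_inside (hstrip ⟨M - 1 - j, by omega⟩) hin
  have hqp : P.q i = P.p i + 2 * P.η * j + m := by
    rw [← hm]; simp only [Params.q, Params.p]; ring
  have hqi := hq i
  -- `q_i` and the shifted `p_i` lie in one strip of width 1, so they cannot differ by a nonzero
  -- integer.
  have hm0 : m = 0 := by
    have h1 := congrArg Complex.re hqp
    rw [Complex.add_re] at h1
    simp only [Complex.intCast_re] at h1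
    simp only [Set.mem_ofPred_eq] at hqi
    have h2 : (m : ℝ) < 1 := by linarith
    have h3 : (-1 : ℝ) < m := by linarith
    have h2' : m < 1 := by exact_mod_cast h2
    have h3' : -1 < m := by exact_mod_cast h3
    omega
  rw [hm0] at hqp
  apply (hout ⟨M - 1 - j, by omega⟩ i).1
  rw [hqp]; simpa using hin

/-! ### Column factors of the squared norms -/

/-- The dynamic parameter seen by column `n` after `N` particles. -/
def height (P : Params) (lam : ℂ) (n N : ℕ) : ℂ := lam + 2 * P.η * (2 * N - P.sumΛ n)

theorem height_succ (P : Params) (lam : ℂ) (n N k : ℕ) :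
    height P lam (n + 1) (N + k) = height P lam n N + 2 * P.η * (2 * k - P.Λ n) := by
  simp only [height, Params.sumΛ, Finset.sum_range_succ]; push_cast; ring

/-- The contribution of `k` particles in column `i` to the squared norm. -/
def colFactor (P : Params) (i : ℕ) (X : ℂ) (k : ℕ) : ℂ :=
  ∏ j ∈ Finset.range k, f (X + 2 * P.η * (k + j - P.Λ i)) * f (X + 2 * P.η * (1 + j))
    / f (2 * P.η * (P.Λ i - j))

theorem colFactor_zero (P : Params) (i : ℕ) (X : ℂ) : colFactor P i X 0 = 1 := by
  simp [colFactor]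

theorem prod_range_shift (F : ℕ → ℂ) (k : ℕ) :
    (∏ j ∈ Finset.range k, F (j + 1)) * F 0 = (∏ j ∈ Finset.range k, F j) * F k := by
  rw [← Finset.prod_range_succ', Finset.prod_range_succ]

/-- Both numerator products run along arithmetic progressions of step `2η`, so shifting `X` by `2η`
trades the first factor of each for the next one. This governs the weights that preserve the
occupation of a column; `colFactor_succ` governs those that change it. -/
theorem colFactor_shift (P : Params) (i : ℕ) (X : ℂ) (k : ℕ) :
    colFactor P i (X + 2 * P.η) k * (f (X + 2 * P.η * (k - P.Λ i)) * f (X + 2 * P.η)) =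
      colFactor P i X k * (f (X + 2 * P.η * (2 * k - P.Λ i)) * f (X + 2 * P.η * (k + 1))) := by
  have h1 := prod_range_shift (fun j : ℕ => f (X + 2 * P.η * (k + j - P.Λ i))) k
  have h2 := prod_range_shift (fun j : ℕ => f (X + 2 * P.η * (1 + j))) k
  simp only [colFactor, Finset.prod_div_distrib, Finset.prod_mul_distrib]
  have e1 : ∀ j : ℕ, X + 2 * P.η + 2 * P.η * (k + j - P.Λ i)
      = X + 2 * P.η * (k + (j + 1 : ℕ) - P.Λ i) := fun j => by push_cast; ring
  have e2 : ∀ j : ℕ, X + 2 * P.η + 2 * P.η * (1 + j)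
      = X + 2 * P.η * (1 + (j + 1 : ℕ)) := fun j => by push_cast; ring
  simp only [e1, e2]
  have e3 : X + 2 * P.η * (k + (0 : ℕ) - P.Λ i) = X + 2 * P.η * (k - P.Λ i) := by
    push_cast; ring
  have e4 : X + 2 * P.η * (1 + (0 : ℕ)) = X + 2 * P.η := by push_cast; ring
  have e5 : X + 2 * P.η * (k + k - P.Λ i) = X + 2 * P.η * (2 * k - P.Λ i) := by ring
  have e6 : X + 2 * P.η * (1 + k) = X + 2 * P.η * (k + 1) := by ring
  simp only [e3, e4, e5, e6] at h1 h2
  rw [div_mul_eq_mul_div, div_mul_eq_mul_div]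
  congr 1
  linear_combination (∏ j ∈ Finset.range k, f (X + 2 * P.η * (1 + (j + 1 : ℕ)))) *
    f (X + 2 * P.η) * h1 + (∏ j ∈ Finset.range k, f (X + 2 * P.η * (k + j - P.Λ i))) *
    f (X + 2 * P.η * (2 * k - P.Λ i)) * h2

theorem colFactor_succ (P : Params) (i : ℕ) (X : ℂ) (k : ℕ)
    (hk : f (2 * P.η * (P.Λ i - k)) ≠ 0) :
    colFactor P i X (k + 1) * f (2 * P.η * (P.Λ i - k)) =
      colFactor P i (X + 2 * P.η) k *
        (f (X + 2 * P.η * (2 * k + 1 - P.Λ i)) * f (X + 2 * P.η)) := by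
  simp only [colFactor, Finset.prod_div_distrib, Finset.prod_mul_distrib]
  rw [Finset.prod_range_succ (fun j : ℕ => f (2 * P.η * (P.Λ i - j))),
    Finset.prod_range_succ (fun j : ℕ => f (X + 2 * P.η * ((k + 1 : ℕ) + j - P.Λ i))),
    Finset.prod_range_succ' (fun j : ℕ => f (X + 2 * P.η * (1 + j)))]
  have e1 : ∀ j : ℕ, X + 2 * P.η + 2 * P.η * (k + j - P.Λ i)
      = X + 2 * P.η * ((k + 1 : ℕ) + j - P.Λ i) := fun j => by push_cast; ring
  have e2 : ∀ j : ℕ, X + 2 * P.η + 2 * P.η * (1 + j)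
      = X + 2 * P.η * (1 + (j + 1 : ℕ)) := fun j => by push_cast; ring
  have e4 : X + 2 * P.η * (1 + (0 : ℕ)) = X + 2 * P.η := by push_cast; ring
  have e5 : X + 2 * P.η * ((k + 1 : ℕ) + k - P.Λ i) = X + 2 * P.η * (2 * k + 1 - P.Λ i) := by
    push_cast; ring
  simp only [e1, e2, e4, e5]
  generalize f (2 * P.η * (P.Λ i - k)) = K at *
  generalize (∏ j ∈ Finset.range k, f (2 * P.η * (P.Λ i - j))) = Q
  rw [← div_div, div_mul_cancel₀ _ hk, div_mul_eq_mul_div]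
  congr 1
  ring

/-! ### Stochastic weights -/

/-- The weight of a column with `k` particles that no path enters and none leaves. -/
def weightA (P : Params) (i : ℕ) (H u : ℂ) (k : ℕ) : ℂ :=
  f (P.q i - u - 2 * P.η * k) * f (H + 2 * P.η * (k + 1 - P.Λ i)) /
    (f (P.q i - u) * f (H + 2 * P.η * (2 * k + 1 - P.Λ i)))

/-- The weight of a column with `k` particles that a path crosses. -/
def weightD (P : Params) (i : ℕ) (H u : ℂ) (k : ℕ) : ℂ :=
  f (P.p i - u + 2 * P.η * k) * f (H + 2 * P.η * (k + 1)) /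
    (f (P.q i - u) * f (H + 2 * P.η * (2 * k + 1 - P.Λ i)))

/-- The three-term relation produces exactly the `u`-dependent numerator of the entry `c`; in
`one_sub_weightD` it produces that of `b`. This is the source of stochasticity. -/
theorem one_sub_weightA (P : Params) (i : ℕ) (H u : ℂ) (k : ℕ) (hq : f (P.q i - u) ≠ 0)
    (hZ : f (H + 2 * P.η * (2 * k + 1 - P.Λ i)) ≠ 0) :
    1 - weightA P i H u k = f (2 * P.η * k) * f (H + P.p i - u + 2 * P.η * (k + 1)) /
      (f (P.q i - u) * f (H + 2 * P.η * (2 * k + 1 - P.Λ i))) := by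
  have h := f_mul_sub_f_mul (P.q i - u - 2 * P.η * k) (H + 2 * P.η * (k + 1 - P.Λ i))
    (2 * P.η * k)
  have e1 : P.q i - u - 2 * P.η * k + 2 * P.η * k = P.q i - u := by ring
  have e2 : H + 2 * P.η * (k + 1 - P.Λ i) + 2 * P.η * k
      = H + 2 * P.η * (2 * k + 1 - P.Λ i) := by ring
  have e3 : P.q i - u - 2 * P.η * k + (H + 2 * P.η * (k + 1 - P.Λ i)) + 2 * P.η * k
      = H + P.p i - u + 2 * P.η * (k + 1) := by simp only [Params.q, Params.p]; ring
  rw [e1, e2, e3] at h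
  rw [weightA, eq_div_iff (mul_ne_zero hq hZ), sub_mul, one_mul,
    div_mul_cancel₀ _ (mul_ne_zero hq hZ), h]

theorem one_sub_weightD (P : Params) (i : ℕ) (H u : ℂ) (k : ℕ) (hq : f (P.q i - u) ≠ 0)
    (hZ : f (H + 2 * P.η * (2 * k + 1 - P.Λ i)) ≠ 0) :
    1 - weightD P i H u k = f (2 * P.η * (P.Λ i - k)) * f (H - P.q i + u + 2 * P.η * (k + 1)) /
      (f (P.q i - u) * f (H + 2 * P.η * (2 * k + 1 - P.Λ i))) := by
  have h := f_mul_sub_f_mul (-(P.p i - u + 2 * P.η * k)) (H + 2 * P.η * (k + 1))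
    (-(2 * P.η * (P.Λ i - k)))
  have e1 : -(P.p i - u + 2 * P.η * k) + -(2 * P.η * (P.Λ i - k)) = -(P.q i - u) := by
    simp only [Params.q, Params.p]; ring
  have e2 : H + 2 * P.η * (k + 1) + -(2 * P.η * (P.Λ i - k))
      = H + 2 * P.η * (2 * k + 1 - P.Λ i) := by ring
  have e3 : -(P.p i - u + 2 * P.η * k) + (H + 2 * P.η * (k + 1)) + -(2 * P.η * (P.Λ i - k))
      = H - P.q i + u + 2 * P.η * (k + 1) := by simp only [Params.q, Params.p]; ring
  rw [e1, e2, e3] at h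
  simp only [f_neg] at h
  rw [weightD, eq_div_iff (mul_ne_zero hq hZ), sub_mul, one_mul,
    div_mul_cancel₀ _ (mul_ne_zero hq hZ)]
  linear_combination -h

theorem q_sub (P : Params) (i : ℕ) (u : ℂ) :
    P.z i - u + (P.Λ i + 1) * P.η = P.q i - u := by
  simp only [Params.q]; ring

/-- Here `H` is the height computed from the source. With no incoming path the target already has
one particle more, so the operator sees `H + 4η`; with an incoming path it sees `H`. The source norm
is taken at `H + 2η` because its dynamic parameter is shifted. The factors `f H * f (H + 2η)` in the
other identities normalize the edges that carry a path. -/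
theorem localOp_a (P : Params) (i : ℕ) (H u : ℂ) (k : ℕ) (hX : f (H + 4 * P.η) ≠ 0)
    (hZ : f (H + 2 * P.η * (2 * k + 1 - P.Λ i)) ≠ 0) :
    localOp P i (H + 4 * P.η) u k k 0 0 * colFactor P i (H + 2 * P.η) k =
      weightA P i H u k * colFactor P i (H + 4 * P.η) k := by
  have h := colFactor_shift P i (H + 2 * P.η) k
  have e1 : H + 2 * P.η + 2 * P.η = H + 4 * P.η := by ring
  have e2 : H + 2 * P.η + 2 * P.η * (k - P.Λ i) = H + 2 * P.η * (k + 1 - P.Λ i) := by ring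
  have e3 : H + 2 * P.η + 2 * P.η * (2 * k - P.Λ i) = H + 2 * P.η * (2 * k + 1 - P.Λ i) := by
    ring
  have e4 : H + 4 * P.η + 2 * k * P.η = H + 2 * P.η + 2 * P.η * (k + 1) := by ring
  have e5 : P.z i - u + (P.Λ i + 1 - 2 * k) * P.η = P.q i - u - 2 * P.η * k := by
    simp only [Params.q]; ring
  rw [e1, e2, e3] at h
  simp only [localOp, weightA, q_sub, e4, e5, Matrix.of_apply, Matrix.cons_val', Matrix.cons_val_zero,
    if_true]
  generalize f (H + 4 * P.η) = F at *
  generalize f (H + 2 * P.η * (2 * k + 1 - P.Λ i)) = Z at *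
  -- Both sides then contain a division by zero, hence vanish.
  by_cases hq : f (P.q i - u) = 0
  · simp [hq]
  generalize f (P.q i - u) = Q at *
  generalize f (P.q i - u - 2 * P.η * k) = R at *
  generalize colFactor P i (H + 4 * P.η) k = G at *
  field_simp
  linear_combination -R * h

theorem localOp_b (P : Params) (i : ℕ) (H u : ℂ) (k : ℕ) (hX : f H ≠ 0)
    (hq : f (P.q i - u) ≠ 0) (hk : f (2 * P.η * (P.Λ i - k)) ≠ 0)
    (hZ : f (H + 2 * P.η * (2 * k + 1 - P.Λ i)) ≠ 0) :
    localOp P i H u k (k + 1) 0 1 * colFactor P i (H + 2 * P.η) k * (f H * f (H + 2 * P.η)) =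
      f (2 * P.η) * (1 - weightD P i H u k) * colFactor P i H (k + 1) := by
  have h := colFactor_succ P i H k hk
  have e5 : -H + P.z i - u + (P.Λ i - 1 - 2 * k) * P.η
      = -(H - P.q i + u + 2 * P.η * (k + 1)) := by
    simp only [Params.q]; ring
  rw [one_sub_weightD P i H u k hq hZ]
  simp only [localOp, q_sub, e5, f_neg, Matrix.of_apply, Matrix.cons_val', Matrix.cons_val_zero,
    Matrix.cons_val_one, if_true]
  field_simp
  linear_combination -f (H - P.q i + u + 2 * P.η * (k + 1)) * f (2 * P.η) * h

theorem localOp_c (P : Params) (i : ℕ) (H u : ℂ) (k : ℕ) (hη : f (2 * P.η) ≠ 0)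
    (hX : f (H + 4 * P.η) ≠ 0)
    (hq : f (P.q i - u) ≠ 0) (hk : f (2 * P.η * (P.Λ i - k)) ≠ 0)
    (hZ : f (H + 2 * P.η * (2 * (k + 1 : ℕ) + 1 - P.Λ i)) ≠ 0) :
    localOp P i (H + 4 * P.η) u (k + 1) k 1 0 * colFactor P i (H + 2 * P.η) (k + 1) *
        f (2 * P.η) =
      (1 - weightA P i H u (k + 1)) * (f (H + 2 * P.η * (2 * (k + 1 : ℕ) - P.Λ i)) *
        f (H + 2 * P.η * (2 * (k + 1 : ℕ) - P.Λ i) + 2 * P.η)) *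
        colFactor P i (H + 4 * P.η) k := by
  have h := colFactor_succ P i (H + 2 * P.η) k hk
  rw [one_sub_weightA P i H u (k + 1) hq hZ]
  have e1 : H + 2 * P.η + 2 * P.η = H + 4 * P.η := by ring
  have e2 : H + 2 * P.η + 2 * P.η * (2 * k + 1 - P.Λ i)
      = H + 2 * P.η * (2 * (k + 1 : ℕ) - P.Λ i) := by push_cast; ring
  have e3 : H + 2 * P.η * (2 * (k + 1 : ℕ) - P.Λ i) + 2 * P.η
      = H + 2 * P.η * (2 * (k + 1 : ℕ) + 1 - P.Λ i) := by ring
  have e4 : 2 * (P.Λ i + 1 - (k + 1 : ℕ)) * P.η = 2 * P.η * (P.Λ i - k) := by push_cast; ring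
  have e5 : -(H + 4 * P.η) - P.z i + u + (P.Λ i + 1 - 2 * (k + 1 : ℕ)) * P.η
      = -(H + P.p i - u + 2 * P.η * ((k + 1 : ℕ) + 1)) := by
    simp only [Params.p]; push_cast; ring
  have e6 : 2 * ((k + 1 : ℕ) : ℂ) * P.η = 2 * P.η * (k + 1 : ℕ) := by ring
  rw [e1, e2] at h
  rw [e3]
  simp only [localOp, q_sub, e4, e5, e6, f_neg, Matrix.of_apply, Matrix.cons_val',
    Matrix.cons_val_zero, Matrix.cons_val_one, if_true]
  generalize f (H + 4 * P.η) = F at *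
  generalize colFactor P i (H + 4 * P.η) k = G at *
  field_simp
  linear_combination f (H + P.p i - u + 2 * P.η * ((k + 1 : ℕ) + 1)) *
    f (2 * P.η * (k + 1 : ℕ)) * h

theorem localOp_d (P : Params) (i : ℕ) (H u : ℂ) (k : ℕ) (hX : f H ≠ 0)
    (hZ : f (H + 2 * P.η * (2 * k + 1 - P.Λ i)) ≠ 0) :
    localOp P i H u k k 1 1 * colFactor P i (H + 2 * P.η) k * (f H * f (H + 2 * P.η)) =
      weightD P i H u k * (f (H + 2 * P.η * (2 * k - P.Λ i)) *
        f (H + 2 * P.η * (2 * k - P.Λ i) + 2 * P.η)) * colFactor P i H k := by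
  have h := colFactor_shift P i H k
  have e3 : H + 2 * P.η * (2 * k - P.Λ i) + 2 * P.η
      = H + 2 * P.η * (2 * k + 1 - P.Λ i) := by ring
  have e4 : H - 2 * (P.Λ i - k) * P.η = H + 2 * P.η * (k - P.Λ i) := by ring
  have e5 : P.z i - u + (-P.Λ i + 1 + 2 * k) * P.η = P.p i - u + 2 * P.η * k := by
    simp only [Params.p]; ring
  simp only [localOp, weightD, q_sub, e3, e4, e5, Matrix.of_apply, Matrix.cons_val',
    Matrix.cons_val_zero, Matrix.cons_val_one, if_true]
  by_cases hq : f (P.q i - u) = 0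
  · simp [hq]
  field_simp
  linear_combination f (P.p i - u + 2 * P.η * k) * h

/-! ### Conservation laws of the row operator -/

/-- The sum of the parts of a signature that are smaller than `n`. -/
def wtLT (ν : Signature) (n : ℕ) : ℕ := ∑ i ∈ Finset.range n, i * ν i

/-- The sum of the parts of a signature. -/
def wt (ν : Signature) : ℕ := ∑ i ∈ ν.support, i * ν i

theorem numLT_succ (ν : Signature) (n : ℕ) : numLT ν (n + 1) = numLT ν n + ν n :=
  Finset.sum_range_succ _ _

theorem wtLT_succ (ν : Signature) (n : ℕ) : wtLT ν (n + 1) = wtLT ν n + n * ν n :=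
  Finset.sum_range_succ _ _

theorem numLT_eq_len {ν : Signature} {n : ℕ} (h : ν.support ⊆ Finset.range n) :
    numLT ν n = len ν := by
  unfold numLT len
  rw [Finsupp.degree_apply]
  exact (Finset.sum_subset h fun i _ hi => by simpa using hi).symm

theorem wtLT_eq_wt {ν : Signature} {n : ℕ} (h : ν.support ⊆ Finset.range n) :
    wtLT ν n = wt ν :=
  (Finset.sum_subset h fun i _ hi => by
    simp only [Finsupp.mem_support_iff, not_not] at hi; simp [hi]).symm

theorem numLT_le_len (ν : Signature) (n : ℕ) : numLT ν n ≤ len ν := by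
  rw [← numLT_eq_len (n := max n (ν.support.sup id + 1))]
  · exact Finset.sum_le_sum_of_subset (by simp)
  · intro i hi
    have := Finset.le_sup (f := id) hi
    simp only [id, Finset.mem_range] at this ⊢
    omega

theorem support_subset_range {ν μ : Signature} :
    μ.support ⊆ Finset.range ((μ.support ∪ ν.support).sup id + 1) ∧
      ν.support ⊆ Finset.range ((μ.support ∪ ν.support).sup id + 1) := by
  constructor <;>
  · intro i hi
    have := Finset.le_sup (f := id) (s := μ.support ∪ ν.support) (b := i) (by simp_all)
    simp only [id, Finset.mem_range] at this ⊢
    omega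

theorem sub_weights_eq_height (P : Params) (lam : ℂ) (ν : Signature) (n : ℕ) :
    lam - 2 * P.η * ∑ i ∈ Finset.range n, (P.Λ i - 2 * (ν i : ℂ))
      = height P lam n (numLT ν n) := by
  simp only [height, numLT, Params.sumΛ, Finset.sum_sub_distrib, ← Finset.mul_sum]
  push_cast; ring

theorem tensorOp_succ (P : Params) (lam w : ℂ) (μ ν : Signature) (n : ℕ) (i : Fin 2) :
    tensorOp P lam w μ ν (n + 1) i 1 =
      localOp P n (height P lam n (numLT ν n)) w (μ n) (ν n) i 0 * tensorOp P lam w μ ν n 0 1 +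
      localOp P n (height P lam n (numLT ν n)) w (μ n) (ν n) i 1 * tensorOp P lam w μ ν n 1 1 := by
  rw [tensorOp, sub_weights_eq_height, Matrix.mul_apply, Fin.sum_univ_two]

theorem localOp_a_of_ne (P : Params) (i : ℕ) (X u : ℂ) {k l : ℕ} (h : l ≠ k) :
    localOp P i X u k l 0 0 = 0 := by simp [localOp, h]

theorem localOp_b_of_ne (P : Params) (i : ℕ) (X u : ℂ) {k l : ℕ} (h : l ≠ k + 1) :
    localOp P i X u k l 0 1 = 0 := by simp [localOp, h]

theorem localOp_c_of_ne (P : Params) (i : ℕ) (X u : ℂ) {k l : ℕ} (h : l + 1 ≠ k) :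
    localOp P i X u k l 1 0 = 0 := by simp [localOp, h]

theorem localOp_d_of_ne (P : Params) (i : ℕ) (X u : ℂ) {k l : ℕ} (h : l ≠ k) :
    localOp P i X u k l 1 1 = 0 := by simp [localOp, h]

/-- A path carries one particle to the right. While it travels, counting that particle at the
current column `n` compensates for the weight removed from the source. -/
theorem tensorOp_conservation (P : Params) (lam w : ℂ) (μ ν : Signature) (n : ℕ) :
    (tensorOp P lam w μ ν n 0 1 ≠ 0 → numLT ν n = numLT μ n + 1 ∧ wtLT μ n ≤ wtLT ν n) ∧
    (tensorOp P lam w μ ν n 1 1 ≠ 0 → numLT ν n = numLT μ n ∧ wtLT μ n ≤ wtLT ν n + n) := by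
  induction n with
  | zero => simp [tensorOp, numLT, wtLT]
  | succ n ih =>
    simp only [tensorOp_succ, numLT_succ, wtLT_succ]
    constructor
    · intro h
      by_cases h1 : localOp P n (height P lam n (numLT ν n)) w (μ n) (ν n) 0 0 *
          tensorOp P lam w μ ν n 0 1 = 0
      · rw [h1, zero_add] at h
        obtain ⟨h2, h3⟩ := ih.2 (right_ne_zero_of_mul h)
        have h4 : ν n = μ n + 1 := by
          by_contra h4; exact left_ne_zero_of_mul h (localOp_b_of_ne _ _ _ _ h4)
        rw [h4]; exact ⟨by omega, by rw [mul_add]; omega⟩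
      · obtain ⟨h2, h3⟩ := ih.1 (right_ne_zero_of_mul h1)
        have h4 : ν n = μ n := by
          by_contra h4; exact left_ne_zero_of_mul h1 (localOp_a_of_ne _ _ _ _ h4)
        rw [h4]; exact ⟨by omega, by omega⟩
    · intro h
      by_cases h1 : localOp P n (height P lam n (numLT ν n)) w (μ n) (ν n) 1 0 *
          tensorOp P lam w μ ν n 0 1 = 0
      · rw [h1, zero_add] at h
        obtain ⟨h2, h3⟩ := ih.2 (right_ne_zero_of_mul h)
        have h4 : ν n = μ n := by
          by_contra h4; exact left_ne_zero_of_mul h (localOp_d_of_ne _ _ _ _ h4)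
        rw [h4]; exact ⟨by omega, by omega⟩
      · obtain ⟨h2, h3⟩ := ih.1 (right_ne_zero_of_mul h1)
        have h4 : ν n + 1 = μ n := by
          by_contra h4; exact left_ne_zero_of_mul h1 (localOp_c_of_ne _ _ _ _ h4)
        rw [← h4]; exact ⟨by omega, by rw [mul_add]; omega⟩

theorem tensorOp_eq_zero {P : Params} {lam w : ℂ} {μ ν : Signature}
    (h0 : tensorOp P lam w μ ν 1 0 1 = 0) (h1 : tensorOp P lam w μ ν 1 1 1 = 0) (n : ℕ) :
    tensorOp P lam w μ ν (n + 1) 0 1 = 0 ∧ tensorOp P lam w μ ν (n + 1) 1 1 = 0 := by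
  induction n with
  | zero => exact ⟨h0, h1⟩
  | succ n ih => simp only [tensorOp_succ _ _ _ _ _ (n + 1), ih.1, ih.2]; simp

theorem tensorOp_one_zero {P : Params} {lam w : ℂ} {μ ν : Signature} (hν : ν 0 = 0) :
    tensorOp P lam w μ ν 1 0 1 = 0 := by
  rw [tensorOp_succ, localOp_b_of_ne _ _ _ _ (by omega)]
  simp [tensorOp]

/-- The last claim holds because a path enters column 0 from the left, and the entries `b`, `d`
never remove a particle. -/
theorem Bone_ne_zero {P : Params} {lam w : ℂ} {μ ν : Signature} (h : Bone P ν μ lam w ≠ 0) :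
    len ν = len μ + 1 ∧ wt μ ≤ wt ν ∧ (ν 0 = 0 → μ 0 = 0) := by
  obtain ⟨hμ, hν⟩ := support_subset_range (ν := ν) (μ := μ)
  have := (tensorOp_conservation P lam w μ ν _).1 h
  rw [numLT_eq_len hμ, numLT_eq_len hν, wtLT_eq_wt hμ, wtLT_eq_wt hν] at this
  refine ⟨this.1, this.2, fun h0 => ?_⟩
  by_contra hμ0
  refine h (tensorOp_eq_zero (tensorOp_one_zero h0) ?_ _).1
  rw [tensorOp_succ, localOp_d_of_ne _ _ _ _ (by omega)]
  simp [tensorOp]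

/-- With column 0 empty before and after, its only contribution is the entry `d` on `e_0`, which
contains `f (w - p_0)`. -/
theorem Bone_eq_zero_of_f_eq_zero {P : Params} {lam w : ℂ} {μ ν : Signature}
    (h0 : ν 0 = 0) (hw : f (w - P.p 0) = 0) : Bone P ν μ lam w = 0 := by
  by_contra h
  have hμ := (Bone_ne_zero h).2.2 h0
  refine h (tensorOp_eq_zero (tensorOp_one_zero h0) ?_ _).1
  have e : P.z 0 - w + (-P.Λ 0 + 1 + 2 * (0 : ℕ)) * P.η = -(w - P.p 0) := by
    simp only [Params.p]; push_cast; ring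
  rw [tensorOp_succ, h0, hμ]
  simp only [localOp, e, f_neg, hw]
  simp [tensorOp]

/-! ### The specialization `ρ` -/

/-- The squared norm of a signature up to simple factors. -/
def normProd (P : Params) (lam : ℂ) (ν : Signature) (n : ℕ) : ℂ :=
  ∏ i ∈ Finset.range n, colFactor P i (height P lam i (numLT ν i)) (ν i)

theorem cNorm_eq (P : Params) (ν : Signature) (lam : ℂ) {n : ℕ}
    (hn : ν.support ⊆ Finset.range n) :
    cNorm P ν lam = f (2 * P.η) ^ len ν
      / ((Real.pi : ℂ) ^ len ν * ∏ i ∈ Finset.range (len ν), f (lam + 2 * P.η * i))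
      * normProd P lam ν n := by
  rw [cNorm, normProd]
  congr 1
  rw [← Finset.prod_subset hn (fun i _ hi => by
    simp only [Finsupp.mem_support_iff, not_not] at hi
    rw [hi, colFactor_zero])]
  refine Finset.prod_congr rfl fun i _ => Finset.prod_congr rfl fun j _ => ?_
  congr 3 <;> simp only [height, Params.sumΛ, Finset.sum_range_succ] <;> ring

/-- Nonvanishing conditions satisfied by the transitions into signatures with at most `N` parts. -/
structure Regular (P : Params) (lam : ℂ) (N : ℕ) : Prop where
  eta : f (2 * P.η) ≠ 0
  res : ∀ i m : ℕ, m ≤ 2 * N → f (lam + 2 * P.η * (m - P.sumΛ i)) ≠ 0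
  spin : ∀ i j : ℕ, j < N → f (2 * P.η * (P.Λ i - j)) ≠ 0

theorem Regular.shift {P : Params} {lam : ℂ} {N : ℕ} (h : Regular P lam (N + 1)) :
    Regular P (lam + 2 * P.η) N := by
  refine ⟨h.eta, fun i m hm => ?_, fun i j hj => h.spin i j (by omega)⟩
  have := h.res i (m + 1) (by omega)
  convert this using 2
  push_cast; ring

theorem Regular.height_ne {P : Params} {lam : ℂ} {N : ℕ} (h : Regular P lam N) (i M m : ℕ)
    (hm : 2 * M + m ≤ 2 * N) : f (height P lam i M + 2 * P.η * m) ≠ 0 := by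
  have := h.res i (2 * M + m) hm
  convert this using 2
  simp only [height]; push_cast; ring

theorem Regular.colFactor_ne {P : Params} {lam : ℂ} {N : ℕ} (h : Regular P lam N) (i M k : ℕ)
    (hk : M + k ≤ N) : colFactor P i (height P lam i M) k ≠ 0 := by
  refine Finset.prod_ne_zero_iff.2 fun j hj => ?_
  rw [Finset.mem_range] at hj
  refine div_ne_zero (mul_ne_zero ?_ ?_) (h.spin i j (by omega))
  · have := h.res (i + 1) (2 * M + k + j) (by omega)
    convert this using 2
    simp only [height, Params.sumΛ, Finset.sum_range_succ]; push_cast; ring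
  · have := h.height_ne i M (1 + j) (by omega)
    convert this using 2
    push_cast; ring

theorem Regular.normProd_ne {P : Params} {lam : ℂ} {ν : Signature} (h : Regular P lam (len ν))
    (n : ℕ) : normProd P lam ν n ≠ 0 := by
  refine Finset.prod_ne_zero_iff.2 fun i _ => h.colFactor_ne _ _ _ ?_
  rw [← numLT_succ]
  exact numLT_le_len _ _

theorem Regular.prod_ne {P : Params} {lam : ℂ} {N : ℕ} (h : Regular P lam N) {k : ℕ}
    (hk : k ≤ 2 * N + 1) : ∏ i ∈ Finset.range k, f (lam + 2 * P.η * i) ≠ 0 := by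
  refine Finset.prod_ne_zero_iff.2 fun i hi => ?_
  rw [Finset.mem_range] at hi
  have := h.res 0 i (by omega)
  simpa [Params.sumΛ] using this

theorem Regular.numer_ne {P : Params} {lam : ℂ} {N : ℕ} (h : Regular P lam N) {k : ℕ}
    (hk : k ≤ 2 * N) :
    ∏ i ∈ Finset.range k, f (lam - 2 * P.η * P.Λ 0 + 2 * P.η * (i + 1)) ≠ 0 := by
  refine Finset.prod_ne_zero_iff.2 fun i hi => ?_
  rw [Finset.mem_range] at hi
  have := h.res 1 (i + 1) (by omega)
  simp only [Params.sumΛ, Finset.sum_range_one] at this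
  convert this using 2
  push_cast; ring

theorem Regular.Drho_eq {P : Params} {lam : ℂ} {ν : Signature} (h : Regular P lam (len ν))
    (h0 : ν 0 = 0) {n : ℕ} (hn : ν.support ⊆ Finset.range n) :
    Drho P ν lam = (-1) ^ len ν *
      (∏ i ∈ Finset.range (len ν), f (lam - 2 * P.η * P.Λ 0 + 2 * P.η * (i + 1))) /
        normProd P lam ν n := by
  have h1 := h.prod_ne (k := len ν) (by omega)
  have h2 := h.normProd_ne n
  have h3 : (Real.pi : ℂ) ^ len ν ≠ 0 := pow_ne_zero _ (by exact_mod_cast Real.pi_ne_zero)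
  have h4 := pow_ne_zero (len ν) h.eta
  rw [Drho, if_pos h0, cNorm_eq P ν lam hn, Finset.prod_div_distrib]
  field_simp

theorem Regular.Drho_ne {P : Params} {lam : ℂ} {ν : Signature} (h : Regular P lam (len ν))
    (h0 : ν 0 = 0) : Drho P ν lam ≠ 0 := by
  rw [h.Drho_eq h0 (support_subset_range (ν := ν) (μ := ν)).1]
  exact div_ne_zero (mul_ne_zero (pow_ne_zero _ (by norm_num)) (h.numer_ne (by omega)))
    (h.normProd_ne _)

/-! ### The transitions as a two-state chain -/

/-- The two-state chain with weights `A`, `D` (and `1 - A`, `1 - D`) that reads off the target `ν`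
from the source `μ`, column by column from column `1`. The components are the total weights of
having `ν` as target up to column `n` and no path, respectively a path, leaving that column. -/
def chain (A D : ℕ → ℂ) (μ ν : Signature) : ℕ → ℂ × ℂ
  | 0 => (0, 1)
  | n + 1 =>
    ((if ν (n + 1) = μ (n + 1) then A (n + 1) * (chain A D μ ν n).1 else 0) +
        (if ν (n + 1) = μ (n + 1) + 1 then (1 - D (n + 1)) * (chain A D μ ν n).2 else 0),
      (if ν (n + 1) + 1 = μ (n + 1) then (1 - A (n + 1)) * (chain A D μ ν n).1 else 0) +
        (if ν (n + 1) = μ (n + 1) then D (n + 1) * (chain A D μ ν n).2 else 0))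

/-- The weight `A` along the columns, given the source. -/
def rowA (P : Params) (lam u : ℂ) (μ : Signature) (n : ℕ) : ℂ :=
  weightA P n (height P lam n (numLT μ n)) u (μ n)

/-- The weight `D` along the columns, given the source. -/
def rowD (P : Params) (lam u : ℂ) (μ : Signature) (n : ℕ) : ℂ :=
  weightD P n (height P lam n (numLT μ n)) u (μ n)

theorem chain_conservation {A D : ℕ → ℂ} {μ ν : Signature} (h0 : ν 0 = μ 0) (n : ℕ) :
    ((chain A D μ ν n).1 ≠ 0 → numLT ν (n + 1) = numLT μ (n + 1) + 1) ∧
    ((chain A D μ ν n).2 ≠ 0 → numLT ν (n + 1) = numLT μ (n + 1)) := by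
  induction n with
  | zero => simp [chain, numLT, h0]
  | succ n ih =>
    rw [numLT_succ ν (n + 1), numLT_succ μ (n + 1)]
    by_cases h1 : (chain A D μ ν n).1 = 0 <;> by_cases h2 : (chain A D μ ν n).2 = 0 <;>
      simp only [chain, h1, h2, mul_zero, ite_self, add_zero, zero_add, ne_eq, not_true,
        false_imp_iff, and_self]
    · have := ih.2 h2
      constructor <;> intro h <;> (split_ifs at h with h3) <;> first | omega | exact (h rfl).elim
    · have := ih.1 h1
      constructor <;> intro h <;> (split_ifs at h with h3) <;> first | omega | exact (h rfl).elim
    · have := ih.1 h1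
      have := ih.2 h2
      omega

theorem height_add_one (P : Params) (lam : ℂ) (n N : ℕ) :
    height P lam n (N + 1) = height P lam n N + 4 * P.η := by
  simp only [height]; push_cast; ring

theorem height_shift (P : Params) (lam : ℂ) (n N : ℕ) :
    height P (lam + 2 * P.η) n N = height P lam n N + 2 * P.η := by
  simp only [height]; ring

theorem normProd_succ (P : Params) (lam : ℂ) (ν : Signature) (n : ℕ) :
    normProd P lam ν (n + 1) =
      normProd P lam ν n * colFactor P n (height P lam n (numLT ν n)) (ν n) :=
  Finset.prod_range_succ _ _

/-- The prefactor relating a single row operator to the chain. -/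
def rowFactor (P : Params) (lam u : ℂ) : ℂ :=
  f lam * f (lam + 2 * P.η - 2 * P.η * P.Λ 0) / f (2 * P.η) * (f (u - P.q 0) / f (u - P.p 0))

/-- The gauge transformation, by induction on the columns. The norms of source and target conjugate
the local entries; the state with a path carries the extra normalization `f H * f (H + 2η) / f (2η)`
at its edge, which cancels between neighbouring columns. `rowFactor` compensates for column 0. -/
theorem tensorOp_eq_chain {P : Params} {lam u : ℂ} {μ ν : Signature}
    (h : Regular P lam (len μ + 1)) (hq : ∀ i, f (P.q i - u) ≠ 0) (hp : f (u - P.p 0) ≠ 0)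
    (hμ : μ 0 = 0) (hν : ν 0 = 0) (n : ℕ) :
    rowFactor P lam u * tensorOp P lam u μ ν (n + 1) 0 1 * normProd P (lam + 2 * P.η) μ (n + 1) =
      (chain (rowA P lam u μ) (rowD P lam u μ) μ ν n).1 * normProd P lam ν (n + 1) ∧
    rowFactor P lam u * tensorOp P lam u μ ν (n + 1) 1 1 * normProd P (lam + 2 * P.η) μ (n + 1)
        * f (2 * P.η) =
      (chain (rowA P lam u μ) (rowD P lam u μ) μ ν n).2 *
        (f (height P lam (n + 1) (numLT μ (n + 1))) *
          f (height P lam (n + 1) (numLT μ (n + 1)) + 2 * P.η)) * normProd P lam ν (n + 1) := by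
  have hη := h.eta
  induction n with
  | zero =>
    have hl : f lam ≠ 0 := by simpa [Params.sumΛ] using h.res 0 0 (by omega)
    have hq0 := hq 0
    have e1 : P.z 0 - u + (-P.Λ 0 + 1) * P.η = -(u - P.p 0) := by
      simp only [Params.p]; ring
    have e2 : u - P.q 0 = -(P.q 0 - u) := by ring
    have e3 : lam - 2 * P.Λ 0 * P.η = height P lam 1 0 := by
      simp [height, Params.sumΛ]; ring
    have e4 : lam + 2 * P.η - 2 * P.η * P.Λ 0 = height P lam 1 0 + 2 * P.η := by
      simp [height, Params.sumΛ]; ring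
    have e5 : numLT μ 1 = 0 := by simp [numLT, hμ]
    have e6 : height P lam 0 (numLT ν 0) = lam := by simp [height, Params.sumΛ, numLT]
    refine ⟨by rw [zero_add, tensorOp_one_zero hν]; simp [chain], ?_⟩
    rw [zero_add, e5, tensorOp_succ, e6]
    simp only [normProd, Finset.prod_range_one, hμ, hν, colFactor_zero, chain, rowFactor, localOp,
      q_sub, e2, e4, f_neg, tensorOp, Matrix.of_apply, Matrix.cons_val', Matrix.cons_val_zero,
      Matrix.cons_val_one, if_true, Nat.cast_zero, mul_zero, sub_zero, add_zero, e1, e3]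
    simp only [Matrix.one_apply_eq]
    simp
    generalize f (height P lam 1 0 + 2 * P.η) = K
    generalize f (height P lam 1 0) = K2
    field_simp
  | succ n ih =>
    obtain ⟨ih1, ih2⟩ := ih
    obtain ⟨c1, c2⟩ := chain_conservation (A := rowA P lam u μ) (D := rowD P lam u μ)
      (hν.trans hμ.symm) n
    set m := n + 1 with hm
    set β := (chain (rowA P lam u μ) (rowD P lam u μ) μ ν n).1
    set δ := (chain (rowA P lam u μ) (rowD P lam u μ) μ ν n).2
    have hlen : numLT μ m + μ m ≤ len μ := by rw [← numLT_succ]; exact numLT_le_len _ _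
    set H := height P lam m (numLT μ m) with hH
    have hHne : f H ≠ 0 := by
      have := h.height_ne m (numLT μ m) 0 (by omega)
      simpa using this
    have hH2 : f (H + 2 * P.η) ≠ 0 := by
      have := h.height_ne m (numLT μ m) 1 (by omega)
      simpa using this
    have hH4 : f (H + 4 * P.η) ≠ 0 := by
      rw [hH, ← height_add_one]
      have := h.height_ne m (numLT μ m + 1) 0 (by omega)
      simpa using this
    have hZ : f (H + 2 * P.η * (2 * (μ m : ℂ) + 1 - P.Λ m)) ≠ 0 := by
      have := h.height_ne (m + 1) (numLT μ m + μ m) 1 (by omega)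
      rw [height_succ] at this
      convert this using 2
      push_cast; ring
    have hspin : ∀ k, k ≤ μ m → f (2 * P.η * (P.Λ m - k)) ≠ 0 :=
      fun k hk => h.spin m k (by omega)
    rw [normProd_succ, normProd_succ _ _ _ m, height_shift, ← hH, numLT_succ μ m, height_succ,
      ← hH]
    simp only [tensorOp_succ _ _ _ _ _ m]
    constructor
    · have t1 : localOp P m (height P lam m (numLT ν m)) u (μ m) (ν m) 0 0 *
          colFactor P m (H + 2 * P.η) (μ m) * β =
          (if ν m = μ m then rowA P lam u μ m * β else 0) *
            colFactor P m (height P lam m (numLT ν m)) (ν m) := by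
        -- The target height equals the source height plus `4η` only on the support of the chain, so
        -- the vanishing amplitude is split off; likewise below.
        by_cases hβ : β = 0
        · simp [hβ]
        split_ifs with hl
        · rw [c1 hβ, height_add_one, ← hH, hl, localOp_a P m H u (μ m) hH4 hZ, rowA, ← hH]
          ring
        · rw [localOp_a_of_ne _ _ _ _ hl]; ring
      have t2 : localOp P m (height P lam m (numLT ν m)) u (μ m) (ν m) 0 1 *
          colFactor P m (H + 2 * P.η) (μ m) * (δ * (f H * f (H + 2 * P.η))) =
          f (2 * P.η) * (if ν m = μ m + 1 then (1 - rowD P lam u μ m) * δ else 0) *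
            colFactor P m (height P lam m (numLT ν m)) (ν m) := by
        by_cases hδ : δ = 0
        · simp [hδ]
        split_ifs with hl
        · rw [c2 hδ, ← hH, hl, rowD, ← hH]
          linear_combination δ *
            localOp_b P m H u (μ m) hHne (hq m) (hspin _ le_rfl) hZ
        · rw [localOp_b_of_ne _ _ _ _ hl]; ring
      rw [chain]
      simp only []
      apply mul_right_cancel₀ hη
      linear_combination (localOp P m (height P lam m (numLT ν m)) u (μ m) (ν m) 0 0 *
          colFactor P m (H + 2 * P.η) (μ m) * f (2 * P.η)) * ih1 +
        (localOp P m (height P lam m (numLT ν m)) u (μ m) (ν m) 0 1 *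
          colFactor P m (H + 2 * P.η) (μ m)) * ih2 +
        normProd P lam ν m * f (2 * P.η) * t1 + normProd P lam ν m * t2
    · set Y := H + 2 * P.η * (2 * (μ m : ℂ) - P.Λ m) with hY
      have t1 : localOp P m (height P lam m (numLT ν m)) u (μ m) (ν m) 1 0 *
          colFactor P m (H + 2 * P.η) (μ m) * f (2 * P.η) * β =
          (if ν m + 1 = μ m then (1 - rowA P lam u μ m) * β else 0) * (f Y * f (Y + 2 * P.η)) *
            colFactor P m (height P lam m (numLT ν m)) (ν m) := by
        by_cases hβ : β = 0
        · simp [hβ]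
        split_ifs with hl
        · rw [c1 hβ, height_add_one, ← hH, rowA, ← hH, hY]
          rw [← hl] at hZ ⊢
          linear_combination β *
            localOp_c P m H u (ν m) hη hH4 (hq m) (hspin _ (by omega)) hZ
        · rw [localOp_c_of_ne _ _ _ _ hl]; ring
      have t2 : localOp P m (height P lam m (numLT ν m)) u (μ m) (ν m) 1 1 *
          colFactor P m (H + 2 * P.η) (μ m) * (δ * (f H * f (H + 2 * P.η))) =
          (if ν m = μ m then rowD P lam u μ m * δ else 0) * (f Y * f (Y + 2 * P.η)) *
            colFactor P m (height P lam m (numLT ν m)) (ν m) := by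
        by_cases hδ : δ = 0
        · simp [hδ]
        split_ifs with hl
        · rw [c2 hδ, ← hH, hl, rowD, ← hH]
          linear_combination δ * localOp_d P m H u (μ m) hHne hZ
        · rw [localOp_d_of_ne _ _ _ _ hl]; ring
      rw [chain]
      simp only []
      linear_combination (localOp P m (height P lam m (numLT ν m)) u (μ m) (ν m) 1 0 *
          colFactor P m (H + 2 * P.η) (μ m) * f (2 * P.η)) * ih1 +
        (localOp P m (height P lam m (numLT ν m)) u (μ m) (ν m) 1 1 *
          colFactor P m (H + 2 * P.η) (μ m)) * ih2 +
        normProd P lam ν m * t1 + normProd P lam ν m * t2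

/-- The one-step transition weight. -/
def stepWeight (P : Params) (lam u : ℂ) (κ τ : Signature) : ℂ :=
  -(1 / f (2 * P.η)) * (f (u - P.q 0) / f (u - P.p 0)) *
    (Drho P κ lam / Drho P τ (lam + 2 * P.η)) * (f lam * Bone P κ τ lam u)

theorem stepWeight_eq_zero {P : Params} {lam u : ℂ} {κ τ : Signature}
    (h : ¬ (κ 0 = 0 ∧ τ 0 = 0 ∧ len κ = len τ + 1 ∧ wt τ ≤ wt κ)) :
    stepWeight P lam u κ τ = 0 := by
  by_cases hκ : κ 0 = 0
  · have : Bone P κ τ lam u = 0 := by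
      by_contra hB
      obtain ⟨h1, h2, h3⟩ := Bone_ne_zero hB
      exact h ⟨hκ, h3 hκ, h1, h2⟩
    simp [stepWeight, this]
  · simp [stepWeight, Drho, hκ]

/-- In the quotient of the two `Drho`, the shifted numerator products cancel up to one factor `f
(lam + 2η - 2ηΛ_0)`, which is the one included in `rowFactor`. -/
theorem stepWeight_eq_chain {P : Params} {lam u : ℂ} {κ τ : Signature}
    (h : Regular P lam (len τ + 1)) (hq : ∀ i, f (P.q i - u) ≠ 0) (hp : f (u - P.p 0) ≠ 0)
    (hτ : τ 0 = 0) (hκ : κ 0 = 0) (hlen : len κ = len τ + 1) :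
    stepWeight P lam u κ τ =
      (chain (rowA P lam u τ) (rowD P lam u τ) τ κ ((τ.support ∪ κ.support).sup id)).1 := by
  obtain ⟨s1, s2⟩ := support_subset_range (ν := κ) (μ := τ)
  have key := (tensorOp_eq_chain (ν := κ) h hq hp hτ hκ ((τ.support ∪ κ.support).sup id)).1
  have hκ' : Regular P lam (len κ) := hlen ▸ h
  have nκ := hκ'.normProd_ne ((τ.support ∪ κ.support).sup id + 1)
  have nτ := (h.shift).normProd_ne ((τ.support ∪ κ.support).sup id + 1)
  have hη := h.eta
  rw [stepWeight, hκ'.Drho_eq hκ s2, h.shift.Drho_eq hτ s1, Bone]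
  rw [rowFactor] at key
  have e : ∏ i ∈ Finset.range (len κ), f (lam - 2 * P.η * P.Λ 0 + 2 * P.η * (i + 1)) =
      (∏ i ∈ Finset.range (len τ), f (lam + 2 * P.η - 2 * P.η * P.Λ 0 + 2 * P.η * (i + 1))) *
        f (lam + 2 * P.η - 2 * P.η * P.Λ 0) := by
    rw [hlen, Finset.prod_range_succ']
    congr 1
    · refine Finset.prod_congr rfl fun i _ => ?_
      congr 1; push_cast; ring
    · congr 1; push_cast; ring
  rw [e, hlen]
  have nn := h.shift.numer_ne (k := len τ) (by omega)
  generalize (∏ i ∈ Finset.range (len τ), f (lam + 2 * P.η - 2 * P.η * P.Λ 0 + 2 * P.η * (i + 1)))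
    = Q at *
  generalize normProd P (lam + 2 * P.η) τ ((τ.support ∪ κ.support).sup id + 1) = N1 at *
  generalize normProd P lam κ ((τ.support ∪ κ.support).sup id + 1) = N2 at *
  generalize tensorOp P lam u τ κ ((τ.support ∪ κ.support).sup id + 1) 0 1 = T at *
  generalize f (lam + 2 * P.η - 2 * P.η * P.Λ 0) = R at *
  have hs : ((-1 : ℂ)) ^ len τ ≠ 0 := pow_ne_zero _ (by norm_num)
  rw [pow_succ]
  field_simp at key ⊢
  linear_combination key

/-! ### The total mass of the chain -/

theorem chain_congr {A D : ℕ → ℂ} {μ ν ν' : Signature} {n : ℕ}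
    (h : ∀ i, 1 ≤ i → i ≤ n → ν i = ν' i) : chain A D μ ν n = chain A D μ ν' n := by
  induction n with
  | zero => rfl
  | succ n ih =>
    simp only [chain]
    rw [ih fun i h1 h2 => h i h1 (by omega), h (n + 1) (by omega) le_rfl]

theorem chain_fst_stable {A D : ℕ → ℂ} {μ ν : Signature} (hA : ∀ n, μ n = 0 → A n = 1) {n m : ℕ}
    (hnm : n ≤ m) (hμ : ∀ i, n < i → μ i = 0) (hν : ∀ i, n < i → ν i = 0) :
    (chain A D μ ν m).1 = (chain A D μ ν n).1 := by
  induction m, hnm using Nat.le_induction with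
  | base => rfl
  | succ m hm ih =>
    rw [← ih]
    simp [chain, hμ (m + 1) (by omega), hν (m + 1) (by omega), hA (m + 1) (hμ _ (by omega))]

/-- The signatures with parts between `1` and `n` and multiplicities at most `K`. -/
def box (K n : ℕ) : Finset Signature :=
  (Finset.Icc 1 n).finsupp fun _ => Finset.range (K + 1)

theorem mem_box {K n : ℕ} {ν : Signature} :
    ν ∈ box K n ↔ (∀ i, i = 0 ∨ n < i → ν i = 0) ∧ ∀ i, ν i ≤ K := by
  rw [box, Finset.mem_finsupp_iff]
  constructor
  · rintro ⟨h1, h2⟩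
    have h3 : ∀ i, i = 0 ∨ n < i → ν i = 0 := fun i hi => by
      by_contra h
      have := h1 (Finsupp.mem_support_iff.2 h)
      rw [Finset.mem_Icc] at this; omega
    refine ⟨h3, fun i => ?_⟩
    by_cases hi : i ∈ Finset.Icc 1 n
    · have := h2 i hi
      rw [Finset.mem_range] at this; omega
    · rw [h3 i (by rw [Finset.mem_Icc] at hi; omega)]; omega
  · rintro ⟨h1, h2⟩
    refine ⟨fun i hi => ?_, fun i _ => Finset.mem_range.2 (by have := h2 i; omega)⟩
    rw [Finsupp.mem_support_iff] at hi
    rw [Finset.mem_Icc]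
    by_contra h
    exact hi (h1 i (by omega))

theorem card_box (K n : ℕ) : (box K n).card = (K + 1) ^ n := by
  rw [box, Finset.card_finsupp]; simp

theorem sum_box_succ (K n : ℕ) (F : Signature → ℂ) :
    ∑ ν ∈ box K (n + 1), F ν =
      ∑ ν ∈ box K n, ∑ l ∈ Finset.range (K + 1), F (ν + Finsupp.single (n + 1) l) := by
  rw [← Finset.sum_product']
  symm
  refine Finset.sum_nbij' (fun x => x.1 + Finsupp.single (n + 1) x.2)
    (fun ν => (ν.erase (n + 1), ν (n + 1))) ?_ ?_ ?_ ?_ (fun _ _ => rfl)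
  · rintro ⟨ν, l⟩ h
    rw [Finset.mem_product, mem_box, Finset.mem_range] at h
    obtain ⟨⟨h1, h2⟩, h3⟩ := h
    simp only at h1 h2 h3
    rw [mem_box]
    refine ⟨fun i hi => ?_, fun i => ?_⟩
    · rw [Finsupp.add_apply, h1 i (by omega), Finsupp.single_eq_of_ne (by omega), add_zero]
    · rw [Finsupp.add_apply, Finsupp.single_apply]
      split_ifs with hi
      · rw [h1 i (by omega)]; omega
      · simpa using h2 i
  · intro ν h
    rw [mem_box] at h
    rw [Finset.mem_product, mem_box, Finset.mem_range]
    refine ⟨⟨fun i hi => ?_, fun i => ?_⟩, by have := h.2 (n + 1); simp only; omega⟩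
    · simp only [Finsupp.erase_apply]
      split_ifs with h4
      · rfl
      · exact h.1 i (by omega)
    · simp only [Finsupp.erase_apply]
      split_ifs with h4
      · omega
      · exact h.2 i
  · rintro ⟨ν, l⟩ h
    rw [Finset.mem_product, mem_box] at h
    have h0 : ν (n + 1) = 0 := h.1.1 (n + 1) (by omega)
    ext i
    · simp only [Finsupp.erase_apply, Finsupp.add_apply]
      split_ifs with h4
      · rw [h4, h0]
      · rw [Finsupp.single_eq_of_ne h4, add_zero]
    · simp [h0]
  · intro ν h
    simp only
    rw [Finsupp.erase_add_single]

/-- From each state the two outgoing weights sum to 1, so adding a column preserves the total mass.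
The bound `K` leaves room for one extra particle. -/
theorem sum_box_chain {A D : ℕ → ℂ} {μ : Signature} {K : ℕ} (hK : ∀ i, μ i + 1 ≤ K)
    (hA : ∀ n, μ n = 0 → A n = 1) (n : ℕ) :
    ∑ ν ∈ box K n, ((chain A D μ ν n).1 + (chain A D μ ν n).2) = 1 := by
  induction n with
  | zero =>
    have : box K 0 = {0} := by
      ext ν
      rw [mem_box, Finset.mem_singleton]
      constructor
      · rintro ⟨h, -⟩; ext i; exact h i (by omega)
      · rintro rfl; simp
    simp [this, chain]
  | succ n ih =>
    rw [sum_box_succ, ← ih]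
    refine Finset.sum_congr rfl fun ν hν => ?_
    have h0 : ν (n + 1) = 0 := (mem_box.1 hν).1 _ (by omega)
    have hc : ∀ l, chain A D μ (ν + Finsupp.single (n + 1) l) n = chain A D μ ν n := fun l =>
      chain_congr fun i _ hi => by
        rw [Finsupp.add_apply, Finsupp.single_eq_of_ne (by omega), add_zero]
    simp only [chain, hc, Finsupp.add_apply, h0, Finsupp.single_eq_same, zero_add]
    have hk := hK (n + 1)
    have hA' := hA (n + 1)
    generalize μ (n + 1) = k at *
    simp only [Finset.sum_add_distrib, Finset.sum_ite_eq', Finset.mem_range]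
    rw [if_pos (by omega), if_pos (by omega), if_pos (by omega)]
    -- No particle can be emitted from an empty column; mass is not lost there since `A = 1`.
    have : ∑ l ∈ Finset.range (K + 1), (if l + 1 = k then (1 - A (n + 1)) * (chain A D μ ν n).1
        else 0) = (1 - A (n + 1)) * (chain A D μ ν n).1 := by
      cases k with
      | zero => simp [hA' rfl]
      | succ k =>
        simp only [Nat.add_right_cancel_iff, Finset.sum_ite_eq', Finset.mem_range]
        rw [if_pos (by omega)]
    rw [this]
    ring

/-! ### Bounds for the chain -/

/-- Powers of `ε` record weight, a travelling path at column `n` counting as a part of size `n`. The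
constant `c i` is paid only where source or target has particles. In empty columns the path costs `ε
h(n+1)/h(n)`, so the scales `h` telescope. This matters because `c` will grow exponentially with the
column. -/
theorem chain_bound {A D : ℕ → ℂ} {μ : Signature} {h c : ℕ → ℝ} {ε : ℝ} (hε : 0 < ε)
    (hh : ∀ n, 1 ≤ h n) (hc : ∀ n, 1 ≤ c n) (hA0 : ∀ n, μ n = 0 → A n = 1)
    (hD0 : ∀ n, μ n = 0 → ‖D n‖ * h n ≤ ε * h (n + 1))
    (hA : ∀ n, ‖A n‖ ≤ c n) (hC : ∀ n, ‖1 - A n‖ ≤ c n * h (n + 1))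
    (hD : ∀ n, ‖D n‖ * h n ≤ c n * ε * h (n + 1)) (hB : ∀ n, ‖1 - D n‖ * h n ≤ c n * ε)
    (ν : Signature) (n : ℕ) :
    ‖(chain A D μ ν n).1‖ * ε ^ wtLT μ (n + 1) ≤
        (∏ i ∈ Finset.range (n + 1), c i ^ (μ i + ν i)) * ε ^ wtLT ν (n + 1) ∧
      ‖(chain A D μ ν n).2‖ * ε ^ wtLT μ (n + 1) ≤
        (∏ i ∈ Finset.range (n + 1), c i ^ (μ i + ν i)) * ε ^ (wtLT ν (n + 1) + n) *
          h (n + 1) := by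
  induction n with
  | zero =>
    have h1 : 1 ≤ c 0 ^ (μ 0 + ν 0) := one_le_pow₀ (hc 0)
    simp only [chain, wtLT, Finset.prod_range_one, zero_add, Finset.sum_range_one, zero_mul,
      pow_zero, norm_zero, norm_one, mul_one]
    exact ⟨by linarith, one_le_mul_of_one_le_of_one_le h1 (hh 1)⟩
  | succ n ih =>
    obtain ⟨ih1, ih2⟩ := ih
    simp only [chain]
    set m := n + 1 with hm
    have hM : 0 < ∏ i ∈ Finset.range m, c i ^ (μ i + ν i) :=
      Finset.prod_pos fun i _ => pow_pos (lt_of_lt_of_le one_pos (hc i)) _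
    rw [Finset.prod_range_succ _ m, wtLT_succ _ m, wtLT_succ _ m]
    generalize (∏ i ∈ Finset.range m, c i ^ (μ i + ν i)) = M at *
    set β := (chain A D μ ν n).1
    set δ := (chain A D μ ν n).2
    have hc0 : 0 < c m := lt_of_lt_of_le one_pos (hc m)
    have hhm : 0 < h m := lt_of_lt_of_le one_pos (hh m)
    have hhm1 : 0 < h (m + 1) := lt_of_lt_of_le one_pos (hh (m + 1))
    have cpow : ∀ j, 1 ≤ j → c m ≤ c m ^ j := fun j hj => le_self_pow₀ (hc m) (by omega)
    have hεp : ∀ j, 0 < ε ^ j := fun j => pow_pos hε j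
    have hpos : 0 ≤ M * c m ^ (μ m + ν m) := by positivity
    rcases lt_trichotomy (ν m) (μ m) with hlt | heq | hgt
    · rw [if_neg (by omega), if_neg (by omega), if_neg (show ¬ ν m = μ m by omega), add_zero,
        add_zero, norm_zero, zero_mul]
      refine ⟨by positivity, ?_⟩
      split_ifs with h1
      · rw [norm_mul, ← h1]
        calc ‖1 - A m‖ * ‖β‖ * ε ^ (wtLT μ m + m * (ν m + 1))
            = ‖1 - A m‖ * (‖β‖ * ε ^ wtLT μ m) * ε ^ (m * (ν m + 1)) := by rw [pow_add]; ring
          _ ≤ (c m * h (m + 1)) * (M * ε ^ wtLT ν m) * ε ^ (m * (ν m + 1)) := by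
              gcongr
              exact hC m
          _ = M * c m * ε ^ (wtLT ν m + m * ν m + m) * h (m + 1) := by
              rw [mul_add, pow_add, pow_add, pow_add, pow_add]; ring
          _ ≤ _ := by
              gcongr
              exact cpow _ (by omega)
      · rw [norm_zero, zero_mul]; positivity
    · rw [if_pos heq, if_neg (by omega), if_neg (by omega), if_pos heq, add_zero, zero_add,
        norm_mul, norm_mul, heq]
      constructor
      · have hAm : ‖A m‖ ≤ c m ^ (μ m + μ m) := by
          by_cases h0 : μ m = 0
          · rw [hA0 m h0, h0]; simp
          · exact (hA m).trans (cpow _ (by omega))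
        calc ‖A m‖ * ‖β‖ * ε ^ (wtLT μ m + m * μ m)
            = ‖A m‖ * (‖β‖ * ε ^ wtLT μ m) * ε ^ (m * μ m) := by rw [pow_add]; ring
          _ ≤ c m ^ (μ m + μ m) * (M * ε ^ wtLT ν m) * ε ^ (m * μ m) := by gcongr
          _ = _ := by rw [pow_add ε]; ring
      · have hDm : ‖D m‖ * h m ≤ c m ^ (μ m + μ m) * ε * h (m + 1) := by
          by_cases h0 : μ m = 0
          · rw [h0]; simpa using hD0 m h0
          · refine (hD m).trans ?_
            gcongr
            exact cpow _ (by omega)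
        calc ‖D m‖ * ‖δ‖ * ε ^ (wtLT μ m + m * μ m)
            = ‖D m‖ * (‖δ‖ * ε ^ wtLT μ m) * ε ^ (m * μ m) := by rw [pow_add]; ring
          _ ≤ ‖D m‖ * (M * ε ^ (wtLT ν m + n) * h m) * ε ^ (m * μ m) := by gcongr
          _ = (‖D m‖ * h m) * (M * ε ^ (wtLT ν m + n) * ε ^ (m * μ m)) := by ring
          _ ≤ (c m ^ (μ m + μ m) * ε * h (m + 1)) *
                (M * ε ^ (wtLT ν m + n) * ε ^ (m * μ m)) := by gcongr
          _ = _ := by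
              rw [pow_add ε _ m, hm, pow_add ε _ (m * μ m), pow_add ε _ n, pow_succ ε n]; ring
    · rw [if_neg (by omega), if_neg (show ¬ ν m + 1 = μ m by omega),
        if_neg (show ¬ ν m = μ m by omega), add_zero, norm_zero, zero_mul, zero_add]
      refine ⟨?_, by positivity⟩
      split_ifs with h1
      · rw [norm_mul, h1]
        calc ‖1 - D m‖ * ‖δ‖ * ε ^ (wtLT μ m + m * μ m)
            = ‖1 - D m‖ * (‖δ‖ * ε ^ wtLT μ m) * ε ^ (m * μ m) := by rw [pow_add]; ring
          _ ≤ ‖1 - D m‖ * (M * ε ^ (wtLT ν m + n) * h m) * ε ^ (m * μ m) := by gcongr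
          _ = (‖1 - D m‖ * h m) * (M * ε ^ (wtLT ν m + n) * ε ^ (m * μ m)) := by ring
          _ ≤ (c m * ε) * (M * ε ^ (wtLT ν m + n) * ε ^ (m * μ m)) :=
              mul_le_mul_of_nonneg_right (hB m) (by positivity)
          _ = M * c m * ε ^ (wtLT ν m + m * (μ m + 1)) := by
              rw [mul_add, mul_one, pow_add ε, pow_add ε, pow_add ε, hm, pow_succ ε n]; ring
          _ ≤ _ := by
              gcongr
              exact cpow _ (by omega)
      · rw [norm_zero, zero_mul]; positivity

/-- Quantitative conditions for the transitions into signatures with at most `N` parts. -/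
structure Controlled (P : Params) (lam u : ℂ) (N : ℕ) (A ε : ℝ) : Prop where
  regular : Regular P lam N
  eps_pos : 0 < ε
  eps_le : ε ≤ 1
  one_le : 1 ≤ A
  decay : ∃ C : ℝ, ∀ m ≤ 2 * N, ∀ i : ℕ,
    growth (lam + 2 * P.η * (m - P.sumΛ i)) ≤ C * A ^ i * ‖f (lam + 2 * P.η * (m - P.sumΛ i))‖
  compare : ∃ θ > 0, ∀ i, θ * growth (P.q i - P.p i) ≤ ‖f (P.q i - u)‖
  small : ∀ i, ‖f (P.p i - u)‖ * growth (P.q i - P.p i) ≤ ε * ‖f (P.q i - u)‖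
  near : ∀ i, growth (P.p i - u) ≤ 2

theorem Controlled.q_ne {P : Params} {lam u : ℂ} {N : ℕ} {A ε : ℝ}
    (hc : Controlled P lam u N A ε) (i : ℕ) : f (P.q i - u) ≠ 0 := by
  obtain ⟨θ, hθ, h⟩ := hc.compare
  exact norm_pos_iff.1 (lt_of_lt_of_le (mul_pos hθ (growth_pos _)) (h i))

theorem q_sub_p (P : Params) (i : ℕ) : P.q i - P.p i = 2 * P.η * P.Λ i := by
  simp only [Params.q, Params.p]; ring

/-- All arguments differ from `q_i - p_i`, `p_i - u` or the denominator's argument by multiples of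
`2η`, or by `q_i - p_i` itself. The growth of `q_i - p_i` in the numerator is absorbed by `f (q_i -
u)`, so the bound is uniform in the column. -/
theorem weight_bounds {P : Params} {u H : ℂ} {i k l : ℕ} {θ : ℝ} (hθ : 0 < θ)
    (hq : θ * growth (P.q i - P.p i) ≤ ‖f (P.q i - u)‖) (hp : growth (P.p i - u) ≤ 2)
    (hkl : k ≤ l)
    (hZ : f (H + 2 * P.η * (2 * k + 1 - P.Λ i)) ≠ 0) :
    ‖weightA P i H u k‖ ≤ 2 * growth (2 * P.η) ^ (4 * l) / θ *
        (growth (H + 2 * P.η * (2 * k + 1 - P.Λ i)) / ‖f (H + 2 * P.η * (2 * k + 1 - P.Λ i))‖) ∧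
      ‖weightD P i H u k‖ ≤ 2 * growth (2 * P.η) ^ (4 * l) / θ *
        (growth (H + 2 * P.η * (2 * k + 1 - P.Λ i)) /
          ‖f (H + 2 * P.η * (2 * k + 1 - P.Λ i))‖) := by
  set Z := H + 2 * P.η * (2 * k + 1 - P.Λ i) with hZd
  set G := growth (2 * P.η)
  have hG1 : 1 ≤ G := one_le_growth _
  have hgq := growth_pos (P.q i - P.p i)
  have hfq : 0 < ‖f (P.q i - u)‖ := lt_of_lt_of_le (mul_pos hθ hgq) hq
  have hfZ : 0 < ‖f Z‖ := norm_pos_iff.2 hZ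
  have hGk : growth (2 * P.η * k) ≤ G ^ k := by
    have := growth_nsmul_le k (2 * P.η)
    rwa [mul_comm (k : ℂ)] at this
  have n1 : ‖f (P.q i - u - 2 * P.η * k)‖ ≤ growth (P.q i - P.p i) * 2 * G ^ k := by
    have e : P.q i - u - 2 * P.η * k = (P.q i - P.p i) + (P.p i - u) + -(2 * P.η * k) := by ring
    refine (norm_f_le_growth _).trans ?_
    rw [e]
    refine (growth_add_le _ _).trans ?_
    rw [growth_neg]
    exact mul_le_mul ((growth_add_le _ _).trans (by gcongr)) hGk (growth_pos _).le (by positivity)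
  have n2 : ‖f (H + 2 * P.η * (k + 1 - P.Λ i))‖ ≤ growth Z * G ^ k := by
    have e : H + 2 * P.η * (k + 1 - P.Λ i) = Z + -(2 * P.η * k) := by rw [hZd]; ring
    refine (norm_f_le_growth _).trans ?_
    rw [e]
    refine (growth_add_le _ _).trans ?_
    rw [growth_neg]
    gcongr
    exact (growth_pos _).le
  have n3 : ‖f (P.p i - u + 2 * P.η * k)‖ ≤ 2 * G ^ k := by
    refine (norm_f_le_growth _).trans ((growth_add_le _ _).trans ?_)
    gcongr
    exact (growth_pos _).le
  have n4 : ‖f (H + 2 * P.η * (k + 1))‖ ≤ growth Z * G ^ k * growth (P.q i - P.p i) := by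
    have e : H + 2 * P.η * (k + 1) = Z + -(2 * P.η * k) + (P.q i - P.p i) := by
      rw [hZd, q_sub_p]; ring
    refine (norm_f_le_growth _).trans ?_
    rw [e]
    refine (growth_add_le _ _).trans ?_
    gcongr
    refine (growth_add_le _ _).trans ?_
    rw [growth_neg]
    gcongr
    exact (growth_pos _).le
  have hgz := growth_pos Z
  have hpow : G ^ k * G ^ k ≤ G ^ (4 * l) := by
    rw [← pow_add]; exact pow_le_pow_right₀ hG1 (by omega)
  have fin : 2 * growth (P.q i - P.p i) * (G ^ k * G ^ k) * growth Z /
      (‖f (P.q i - u)‖ * ‖f Z‖) ≤ 2 * G ^ (4 * l) / θ * (growth Z / ‖f Z‖) := by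
    rw [div_mul_div_comm, div_le_div_iff₀ (by positivity) (by positivity)]
    calc _ = 2 * (G ^ k * G ^ k) * (θ * growth (P.q i - P.p i)) * (growth Z * ‖f Z‖) := by ring
      _ ≤ 2 * G ^ (4 * l) * ‖f (P.q i - u)‖ * (growth Z * ‖f Z‖) := by gcongr
      _ = _ := by ring
  constructor
  · refine le_trans ?_ fin
    rw [weightA, norm_div, norm_mul, norm_mul]
    refine div_le_div_of_nonneg_right ?_ (by positivity)
    calc _ ≤ (growth (P.q i - P.p i) * 2 * G ^ k) * (growth Z * G ^ k) := by gcongr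
      _ = _ := by ring
  · refine le_trans ?_ fin
    rw [weightD, norm_div, norm_mul, norm_mul]
    refine div_le_div_of_nonneg_right ?_ (by positivity)
    calc _ ≤ (2 * G ^ k) * (growth Z * G ^ k * growth (P.q i - P.p i)) := by gcongr
      _ = _ := by ring

/-- The normalization of the chain in the state with a path. -/
def pathScale (P : Params) (lam : ℂ) (μ : Signature) (n : ℕ) : ℝ :=
  growth (height P lam n (numLT μ n) + 2 * P.η) / ‖f (height P lam n (numLT μ n) + 2 * P.η)‖

theorem height_succ_add (P : Params) (lam : ℂ) (μ : Signature) (n : ℕ) :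
    height P lam (n + 1) (numLT μ (n + 1)) + 2 * P.η =
      height P lam n (numLT μ n) + 2 * P.η * (2 * μ n + 1 - P.Λ n) := by
  rw [numLT_succ, height_succ]; ring

theorem Controlled.height_ne {P : Params} {lam u : ℂ} {N : ℕ} {A ε : ℝ}
    (hc : Controlled P lam u (N + 1) A ε) {μ : Signature} (hμ : len μ = N) (n : ℕ) :
    f (height P lam n (numLT μ n) + 2 * P.η) ≠ 0 := by
  have := hc.regular.height_ne n (numLT μ n) 1 (by have := numLT_le_len μ n; omega)
  simpa using this

theorem Controlled.rowA_eq_one {P : Params} {lam u : ℂ} {N : ℕ} {A ε : ℝ}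
    (hc : Controlled P lam u (N + 1) A ε) {μ : Signature} (hμ : len μ = N) (n : ℕ)
    (hn : μ n = 0) : rowA P lam u μ n = 1 := by
  have h1 := hc.q_ne n
  have h2 := hc.height_ne hμ (n + 1)
  rw [height_succ_add, hn] at h2
  simp only [Nat.cast_zero, mul_zero, zero_add] at h2
  rw [rowA, weightA, hn]
  simp only [Nat.cast_zero, mul_zero, sub_zero, zero_add]
  exact div_self (mul_ne_zero h1 h2)

theorem Controlled.chain_bound {P : Params} {lam u : ℂ} {N : ℕ} {A ε : ℝ}
    (hc : Controlled P lam u (N + 1) A ε) :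
    ∃ C : ℝ, 1 ≤ C ∧ ∀ μ ν : Signature, len μ = N → ∀ n : ℕ,
      ‖(chain (rowA P lam u μ) (rowD P lam u μ) μ ν n).1‖ * ε ^ wtLT μ (n + 1) ≤
        C ^ (numLT μ (n + 1) + numLT ν (n + 1)) * (A ^ 2) ^ (wtLT μ (n + 1) + wtLT ν (n + 1)) *
          ε ^ wtLT ν (n + 1) ∧
      ‖(chain (rowA P lam u μ) (rowD P lam u μ) μ ν n).2‖ * ε ^ wtLT μ (n + 1) ≤
        C ^ (numLT μ (n + 1) + numLT ν (n + 1)) * (A ^ 2) ^ (wtLT μ (n + 1) + wtLT ν (n + 1)) *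
          ε ^ (wtLT ν (n + 1) + n) * (C * A ^ (n + 1)) := by
  have hε := hc.eps_pos
  have hε1 := hc.eps_le
  have hA1 := hc.one_le
  obtain ⟨θ, hθ, hcmp⟩ := hc.compare
  obtain ⟨C₀, hdecay⟩ := hc.decay
  set C₁ := max C₀ 1
  have hC₁ : 1 ≤ C₁ := le_max_right _ _
  set Q : ℝ := 2 * growth (2 * P.η) ^ (4 * N) / θ + 1 with hQ
  have hQ0 : 0 ≤ 2 * growth (2 * P.η) ^ (4 * N) / θ := by
    have := growth_pos (2 * P.η); positivity
  have hQ1 : 1 ≤ Q := by linarith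
  set B : ℕ → ℝ := fun n => C₁ * A ^ (n + 1) with hBdef
  have hB1 : ∀ n, 1 ≤ B n := fun n =>
    one_le_mul_of_one_le_of_one_le hC₁ (one_le_pow₀ hA1)
  -- `B n` dominates the path scale on both sides of column `n`, and `B n ^ 2` covers the two scales
  -- in the absorption weight. Dividing by `ε` pays for occupied columns, where `D` need not be
  -- small. The bound `c n ≤ C (A ^ 2) ^ n` turns the product over particles into length and weight.
  set c : ℕ → ℝ := fun n => 2 * Q * B n ^ 2 / ε with hcdef
  have hcB : ∀ n, 2 * Q * B n ^ 2 ≤ c n * ε := fun n => by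
    rw [hcdef]; simp only; rw [div_mul_cancel₀ _ hε.ne']
  have hBB : ∀ n, B n ≤ B n ^ 2 := fun n => le_self_pow₀ (hB1 n) (by norm_num)
  have hcQ : ∀ n, Q * B n ≤ c n * ε := fun n => by
    refine le_trans ?_ (hcB n)
    have := hBB n
    have := hB1 n
    nlinarith
  have hc1 : ∀ n, c n * ε ≤ c n := fun n => by
    have : 0 ≤ c n := by rw [hcdef]; have := hB1 n; positivity
    nlinarith
  have hcone : ∀ n, 1 ≤ c n := fun n =>
    (one_le_mul_of_one_le_of_one_le hQ1 (hB1 n)).trans ((hcQ n).trans (hc1 n))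
  set C : ℝ := max (2 * Q * C₁ ^ 2 / ε * A ^ 2) C₁ with hC
  have hCC₁ : C₁ ≤ C := le_max_right _ _
  have hC1 : 1 ≤ C := hC₁.trans hCC₁
  have hcC : ∀ n, c n ≤ C * (A ^ 2) ^ n := fun n => by
    calc c n = (2 * Q * C₁ ^ 2 / ε * A ^ 2) * (A ^ 2) ^ n := by
          simp only [hcdef, hBdef]; rw [mul_pow, ← pow_mul, ← pow_mul]; ring
      _ ≤ _ := by
          gcongr
          exact le_max_left _ _
  refine ⟨C, hC1, fun μ ν hμ n => ?_⟩
  set h := pathScale P lam μ with hh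
  have hZ := fun n => hc.height_ne hμ n
  have hZ' : ∀ n, f (height P lam n (numLT μ n) + 2 * P.η * (2 * μ n + 1 - P.Λ n)) ≠ 0 :=
    fun n => by rw [← height_succ_add]; exact hZ _
  have hnum : ∀ n, μ n ≤ N := fun n => by
    have := numLT_le_len μ (n + 1); rw [numLT_succ] at this; omega
  have h1 : ∀ n, 1 ≤ h n := fun n => by
    rw [hh, pathScale, one_le_div (norm_pos_iff.2 (hZ n))]
    exact norm_f_le_growth _
  have hle : ∀ n, h n ≤ C₁ * A ^ n := fun n => by
    rw [hh, pathScale, div_le_iff₀ (norm_pos_iff.2 (hZ n))]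
    have := hdecay (2 * numLT μ n + 1) (by have := numLT_le_len μ n; omega) n
    have e : lam + 2 * P.η * ((2 * numLT μ n + 1 : ℕ) - P.sumΛ n) =
        height P lam n (numLT μ n) + 2 * P.η := by
      simp only [height]; push_cast; ring
    rw [e] at this
    refine this.trans ?_
    gcongr
    exact le_max_left _ _
  have hleB : ∀ n, h n ≤ B n := fun n => (hle n).trans (by
    simp only [hBdef]
    gcongr
    exact Nat.le_succ n)
  have hleB' : ∀ n, h (n + 1) ≤ B n := fun n => hle _
  have hA : ∀ n, ‖rowA P lam u μ n‖ ≤ Q * h (n + 1) := fun n => by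
    have := (weight_bounds hθ (hcmp n) (hc.near n) (hnum n) (hZ' n)).1
    rw [← height_succ_add] at this
    refine this.trans ?_
    rw [hh, pathScale]
    gcongr
    · exact zero_le_one.trans (h1 (n + 1))
    · linarith
  have hD : ∀ n, ‖rowD P lam u μ n‖ ≤ Q * h (n + 1) := fun n => by
    have := (weight_bounds hθ (hcmp n) (hc.near n) (hnum n) (hZ' n)).2
    rw [← height_succ_add] at this
    refine this.trans ?_
    rw [hh, pathScale]
    gcongr
    · exact zero_le_one.trans (h1 (n + 1))
    · linarith
  have hh0 : ∀ n, 0 ≤ h n := fun n => zero_le_one.trans (h1 n)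
  have hQ0' : 0 ≤ Q := zero_le_one.trans hQ1
  have hDn : ∀ n, ‖rowD P lam u μ n‖ * h n ≤ Q * B n * h (n + 1) := fun n => by
    calc _ ≤ (Q * h (n + 1)) * B n :=
          mul_le_mul (hD n) (hleB n) (hh0 n) (mul_nonneg hQ0' (hh0 _))
      _ = _ := by ring
  have key := TrigIRF.chain_bound (A := rowA P lam u μ) (D := rowD P lam u μ) (μ := μ) (h := h)
    (c := c) hε h1 hcone (fun n => hc.rowA_eq_one hμ n) ?_ ?_ ?_ ?_ ?_ ν n
  · have hprod : ∏ i ∈ Finset.range (n + 1), c i ^ (μ i + ν i) ≤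
        C ^ (numLT μ (n + 1) + numLT ν (n + 1)) *
          (A ^ 2) ^ (wtLT μ (n + 1) + wtLT ν (n + 1)) := by
      calc _ ≤ ∏ i ∈ Finset.range (n + 1), (C * (A ^ 2) ^ i) ^ (μ i + ν i) := by
            refine Finset.prod_le_prod (fun i _ => pow_nonneg (zero_le_one.trans (hcone i)) _)
              fun i _ => ?_
            exact pow_le_pow_left₀ (zero_le_one.trans (hcone i)) (hcC i) _
        _ = _ := by
            simp only [mul_pow, Finset.prod_mul_distrib, Finset.prod_pow_eq_pow_sum, ← pow_mul,
              Finset.sum_add_distrib, numLT, wtLT, mul_add]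
            simp only [Finset.mul_sum, mul_assoc]
    refine ⟨key.1.trans (by gcongr), key.2.trans ?_⟩
    gcongr
    · exact hh0 _
    · refine (hle (n + 1)).trans ?_
      gcongr
  -- In an empty column the two heights differ by `q_n - p_n`. The dynamic factors of `D` cancel
  -- those of the path scales, and submultiplicativity of `growth` reduces the claim to `hc.small`.
  · intro n hn
    have h2 := hZ n
    have h3 := hZ (n + 1)
    have hs := hc.small n
    have hfq := norm_pos_iff.2 (hc.q_ne n)
    have e : height P lam n (numLT μ n) + 2 * P.η =
        height P lam (n + 1) (numLT μ (n + 1)) + 2 * P.η + (P.q n - P.p n) := by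
      rw [height_succ_add, hn, q_sub_p]; push_cast; ring
    have hg : growth (height P lam n (numLT μ n) + 2 * P.η) ≤
        growth (height P lam (n + 1) (numLT μ (n + 1)) + 2 * P.η) * growth (P.q n - P.p n) := by
      rw [e]; exact growth_add_le _ _
    have eD : rowD P lam u μ n = f (P.p n - u) * f (height P lam n (numLT μ n) + 2 * P.η) /
        (f (P.q n - u) * f (height P lam (n + 1) (numLT μ (n + 1)) + 2 * P.η)) := by
      rw [rowD, weightD, height_succ_add, hn]
      simp
    rw [eD, hh, pathScale, pathScale, norm_div, norm_mul, norm_mul]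
    have h2' := norm_pos_iff.2 h2
    have h3' := norm_pos_iff.2 h3
    generalize ‖f (height P lam n (numLT μ n) + 2 * P.η)‖ = Z at *
    generalize ‖f (height P lam (n + 1) (numLT μ (n + 1)) + 2 * P.η)‖ = Z' at *
    generalize growth (height P lam n (numLT μ n) + 2 * P.η) = g at *
    have hg'0 := growth_pos (height P lam (n + 1) (numLT μ (n + 1)) + 2 * P.η)
    generalize growth (height P lam (n + 1) (numLT μ (n + 1)) + 2 * P.η) = g' at *
    rw [div_mul_div_comm, mul_div_assoc', div_le_div_iff₀ (by positivity) (by positivity)]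
    calc ‖f (P.p n - u)‖ * Z * g * Z' ≤ ‖f (P.p n - u)‖ * Z * (g' * growth (P.q n - P.p n)) * Z' := by
          gcongr
      _ = (‖f (P.p n - u)‖ * growth (P.q n - P.p n)) * (Z * g' * Z') := by ring
      _ ≤ (ε * ‖f (P.q n - u)‖) * (Z * g' * Z') := by gcongr
      _ = _ := by ring
  · intro n
    refine (hA n).trans (le_trans ?_ ((hcQ n).trans (hc1 n)))
    gcongr
    exact hleB' n
  · intro n
    calc ‖1 - rowA P lam u μ n‖ ≤ 1 + Q * h (n + 1) := by
          refine (norm_sub_le _ _).trans ?_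
          rw [norm_one]
          linarith [hA n]
      _ ≤ 2 * Q * h (n + 1) := by nlinarith [one_le_mul_of_one_le_of_one_le hQ1 (h1 (n + 1))]
      _ ≤ c n * h (n + 1) := by
          refine mul_le_mul_of_nonneg_right (le_trans ?_ ((hcB n).trans (hc1 n))) (hh0 _)
          exact le_mul_of_one_le_right (by positivity) (one_le_pow₀ (hB1 n))
  · intro n
    exact (hDn n).trans (mul_le_mul_of_nonneg_right (hcQ n) (hh0 _))
  · intro n
    calc ‖1 - rowD P lam u μ n‖ * h n ≤ (1 + ‖rowD P lam u μ n‖) * h n := by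
          refine mul_le_mul_of_nonneg_right ((norm_sub_le _ _).trans ?_) (hh0 _)
          rw [norm_one]
      _ = h n + ‖rowD P lam u μ n‖ * h n := by ring
      _ ≤ B n + Q * B n * B n := by
          refine add_le_add (hleB n) ((hDn n).trans ?_)
          have := hB1 n
          gcongr
          exact hleB' n
      _ ≤ 2 * Q * B n ^ 2 := by
          have := hBB n
          have := hB1 n
          nlinarith
      _ ≤ _ := hcB n

/-! ### Sums over signatures -/

theorem wt_add_single (ν : Signature) (i : ℕ) : wt (ν + Finsupp.single i 1) = wt ν + i := by
  have h : ∀ ν : Signature, wt ν = ν.sum fun i k => i * k := fun _ => rfl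
  rw [h, h, Finsupp.sum_add_index' (by simp) (fun a b c => mul_add a b c),
    Finsupp.sum_single_index (by simp), mul_one]

theorem len_add_single (ν : Signature) (i : ℕ) : len (ν + Finsupp.single i 1) = len ν + 1 := by
  simp [len]

theorem len_eq_zero {ν : Signature} : len ν = 0 ↔ ν = 0 := Finsupp.degree_eq_zero_iff ν

theorem exists_add_single {ν : Signature} (h : ν ≠ 0) :
    ∃ x : ℕ × Signature, ν = x.2 + Finsupp.single x.1 1 := by
  obtain ⟨i, hi⟩ := Finsupp.ne_iff.1 h
  refine ⟨(i, ν - Finsupp.single i 1), ?_⟩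
  rw [tsub_add_cancel_of_le]
  rw [Finsupp.single_le_iff]
  exact Nat.one_le_iff_ne_zero.2 hi

/-- The generating function of the signatures of length `N` by weight. -/
def lenWeight (N : ℕ) (t : ℝ) (ν : Signature) : ℝ := if len ν = N then t ^ wt ν else 0

theorem lenWeight_nonneg (N : ℕ) {t : ℝ} (ht : 0 ≤ t) (ν : Signature) : 0 ≤ lenWeight N t ν := by
  unfold lenWeight; split_ifs <;> positivity

/-- Removing a part injects length `N + 1` into pairs of a part and a signature of length `N`, which
brings in a geometric series. -/
theorem summable_lenWeight (N : ℕ) {t : ℝ} (ht : 0 ≤ t) (ht1 : t < 1) :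
    Summable (lenWeight N t) := by
  induction N with
  | zero =>
    refine summable_of_ne_finset_zero (s := {0}) fun ν hν => ?_
    rw [Finset.mem_singleton] at hν
    rw [lenWeight, if_neg (fun h => hν (len_eq_zero.1 h))]
  | succ N ih =>
    have hne : ∀ ν : {ν : Signature | len ν = N + 1}, (ν : Signature) ≠ 0 := by
      rintro ⟨ν, hν⟩ rfl
      simp [len] at hν
    choose σ hσ using fun ν : {ν : Signature | len ν = N + 1} => exists_add_single (hne ν)
    have hinj : Function.Injective σ := fun ν ν' h => by
      apply Subtype.ext
      rw [hσ ν, hσ ν', h]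
    have hG : Summable fun x : ℕ × Signature => t ^ x.1 * lenWeight N t x.2 :=
      (summable_geometric_of_lt_one ht ht1).mul_of_nonneg ih (fun _ => by positivity)
        (lenWeight_nonneg N ht)
    have h2 := hG.comp_injective hinj
    have h3 : lenWeight (N + 1) t = {ν : Signature | len ν = N + 1}.indicator
        (fun ν => t ^ wt ν) := by
      ext ν
      simp only [lenWeight, Set.indicator_apply, Set.mem_ofPred_eq]
    rw [h3, ← summable_subtype_iff_indicator]
    refine h2.congr fun ν => ?_
    have hl : len (σ ν).2 = N := by
      have := ν.2
      rw [Set.mem_ofPred_eq, hσ ν, len_add_single] at this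
      omega
    simp only [Function.comp_apply, lenWeight, if_pos hl]
    rw [← pow_add, add_comm, ← wt_add_single, ← hσ ν]

theorem finite_len_wt (a b : ℕ) : {ν : Signature | len ν ≤ a ∧ wt ν ≤ b}.Finite := by
  refine ((Finset.range (b + 1)).finsupp fun _ => Finset.range (a + 1)).finite_toSet.subset ?_
  rintro ν ⟨h1, h2⟩
  rw [Finset.mem_coe, Finset.mem_finsupp_iff]
  constructor
  · intro i hi
    have h3 : i * ν i ≤ wt ν :=
      Finset.single_le_sum (f := fun i => i * ν i) (fun _ _ => Nat.zero_le _) hi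
    have h4 : 1 ≤ ν i := Nat.one_le_iff_ne_zero.2 (Finsupp.mem_support_iff.1 hi)
    rw [Finset.mem_range]
    nlinarith
  · intro i _
    have := numLT_le_len ν (i + 1)
    rw [numLT_succ] at this
    rw [Finset.mem_range]
    omega

/-! ### One step -/

/-- The power `A ^ 4` arises from `(A ^ 2) ^ (wt τ + wt κ)`, as nonzero transitions do not decrease
the weight. -/
theorem Controlled.stepWeight_bound {P : Params} {lam u : ℂ} {N : ℕ} {A ε : ℝ}
    (hc : Controlled P lam u (N + 1) A ε) (hp : f (u - P.p 0) ≠ 0) :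
    ∃ C : ℝ, 0 ≤ C ∧ ∀ κ τ : Signature, len τ = N →
      ‖stepWeight P lam u κ τ‖ * ε ^ wt τ ≤ C * (A ^ 4) ^ wt κ * ε ^ wt κ := by
  obtain ⟨C, hC, h⟩ := hc.chain_bound
  have hε := hc.eps_pos
  have hA := hc.one_le
  refine ⟨C ^ (2 * N + 1), by positivity, fun κ τ hτ => ?_⟩
  by_cases hs : κ 0 = 0 ∧ τ 0 = 0 ∧ len κ = len τ + 1 ∧ wt τ ≤ wt κ
  · obtain ⟨h1, h2, h3, h4⟩ := hs
    obtain ⟨s1, s2⟩ := support_subset_range (ν := κ) (μ := τ)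
    have := (h τ κ hτ ((τ.support ∪ κ.support).sup id)).1
    rw [numLT_eq_len s1, numLT_eq_len s2, wtLT_eq_wt s1, wtLT_eq_wt s2,
      ← stepWeight_eq_chain (hτ ▸ hc.regular) hc.q_ne hp h2 h1 h3] at this
    refine this.trans ?_
    have e : len τ + len κ = 2 * N + 1 := by omega
    rw [e]
    gcongr ?_ * ?_ * ?_
    rw [← pow_mul, ← pow_mul]
    exact pow_le_pow_right₀ hA (by omega)
  · rw [stepWeight_eq_zero hs, norm_zero, zero_mul]
    have : 0 < A := by linarith
    positivity

/-- Beyond the support of `μ`, the pathless mass of a box is the partial sum of the one-step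
weights. It equals 1 minus the mass with a path, which decays like `((N + 2) A ε) ^ n`; dominated
convergence identifies the limit with the sum. -/
theorem Controlled.hasSum_stepWeight {P : Params} {lam u : ℂ} {N : ℕ} {A ε : ℝ}
    (hc : Controlled P lam u (N + 1) A ε) (hp : f (u - P.p 0) ≠ 0)
    (h4 : A ^ 4 * ε ≤ 1 / 4) (hN : (N + 2) * (A * ε) ≤ 1 / 2)
    {μ : Signature} (hμ : len μ = N) (hμ0 : μ 0 = 0) :
    HasSum (fun κ => stepWeight P lam u κ μ) 1 := by
  have hε := hc.eps_pos
  have hA := hc.one_le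
  have hA0 : 0 < A := by linarith
  have hsum : Summable fun κ => stepWeight P lam u κ μ := by
    obtain ⟨C, hC, h⟩ := hc.stepWeight_bound hp
    refine Summable.of_norm_bounded (g := fun κ => C / ε ^ wt μ * lenWeight (N + 1) (1 / 4) κ)
      ((summable_lenWeight _ (by norm_num) (by norm_num)).mul_left _) fun κ => ?_
    by_cases hl : len κ = N + 1
    · rw [lenWeight, if_pos hl, div_mul_eq_mul_div, le_div_iff₀ (by positivity)]
      refine (h κ μ hμ).trans ?_
      rw [mul_assoc, ← mul_pow]
      gcongr
    · rw [lenWeight, if_neg hl, stepWeight_eq_zero (by omega), norm_zero, mul_zero]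
  set c := chain (rowA P lam u μ) (rowD P lam u μ) μ with hcdef
  set n₀ := μ.support.sup id
  have hμn : ∀ n, n₀ ≤ n → ∀ i, n < i → μ i = 0 := fun n hn i hi => by
    by_contra h
    have : id i ≤ n₀ := Finset.le_sup (f := id) (Finsupp.mem_support_iff.2 h)
    simp only [id] at this
    omega
  have hsupp : ∀ {ν : Signature} {n : ℕ}, (∀ i, n < i → ν i = 0) →
      ν.support ⊆ Finset.range (n + 1) := fun {ν n} h i hi => by
    rw [Finset.mem_range]
    by_contra h'
    exact Finsupp.mem_support_iff.1 hi (h i (by omega))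
  have hbox : ∀ n, n₀ ≤ n → ∀ κ ∈ box (N + 1) n, (c κ n).1 = stepWeight P lam u κ μ := by
    intro n hn κ hκ
    obtain ⟨hκ1, -⟩ := mem_box.1 hκ
    have hκ0 := hκ1 0 (Or.inl rfl)
    have hκn : ∀ i, n < i → κ i = 0 := fun i hi => hκ1 i (Or.inr hi)
    by_cases hl : len κ = N + 1
    · rw [stepWeight_eq_chain (hμ ▸ hc.regular) hc.q_ne hp hμ0 hκ0 (by omega), hcdef]
      obtain ⟨s1, s2⟩ := support_subset_range (ν := κ) (μ := μ)
      refine chain_fst_stable (fun n => hc.rowA_eq_one hμ n) ?_ ?_ ?_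
      · refine Finset.sup_le fun i hi => ?_
        rcases Finset.mem_union.1 hi with hi | hi
        · have := hsupp (hμn n hn) hi
          rw [Finset.mem_range] at this
          simp only [id]; omega
        · have := hsupp hκn hi
          rw [Finset.mem_range] at this
          simp only [id]; omega
      · intro i hi
        by_contra h'
        have := s1 (Finsupp.mem_support_iff.2 h')
        rw [Finset.mem_range] at this; omega
      · intro i hi
        by_contra h'
        have := s2 (Finsupp.mem_support_iff.2 h')
        rw [Finset.mem_range] at this; omega
    · rw [stepWeight_eq_zero (by omega)]
      by_contra h
      have := (chain_conservation (hκ0.trans hμ0.symm) n).1 h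
      rw [numLT_eq_len (hsupp hκn), numLT_eq_len (hsupp (hμn n hn))] at this
      omega
  have hμle : ∀ i, μ i ≤ N := fun i => by
    have := numLT_le_len μ (i + 1); rw [numLT_succ] at this; omega
  have hone : ∀ n, ∑ κ ∈ box (N + 1) n, (c κ n).1 = 1 - ∑ κ ∈ box (N + 1) n, (c κ n).2 := by
    intro n
    rw [eq_sub_iff_add_eq, ← Finset.sum_add_distrib]
    exact sum_box_chain (fun i => by have := hμle i; omega) (fun n => hc.rowA_eq_one hμ n) n
  have hlim0 : Filter.Tendsto (fun n => ∑ κ ∈ box (N + 1) n, (c κ n).2) Filter.atTop (nhds 0) := by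
    obtain ⟨C, hC, h⟩ := hc.chain_bound
    set K := C ^ (2 * N) * (A ^ 2) ^ wt μ * (C * A) / ε ^ wt μ with hK
    have hg : Filter.Tendsto (fun n : ℕ => K * (1 / 2 : ℝ) ^ n) Filter.atTop (nhds 0) := by
      simpa using (tendsto_pow_atTop_nhds_zero_of_lt_one (r := (1 / 2 : ℝ)) (by norm_num)
        (by norm_num)).const_mul K
    refine squeeze_zero_norm' ?_ hg
    filter_upwards [Filter.eventually_ge_atTop n₀] with n hn
    have hterm : ∀ κ ∈ box (N + 1) n, ‖(c κ n).2‖ ≤ K * (A * ε) ^ n := by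
      intro κ hκ
      by_cases h0 : (c κ n).2 = 0
      · rw [h0, norm_zero]; positivity
      have hcons := (chain_conservation (((mem_box.1 hκ).1 0 (Or.inl rfl)).trans hμ0.symm) n).2 h0
      have hb := (h μ κ hμ n).2
      have s := hsupp (hμn n hn)
      rw [hcons, numLT_eq_len s, wtLT_eq_wt s, hμ] at hb
      rw [hK, div_mul_eq_mul_div, le_div_iff₀ (by positivity)]
      refine hb.trans ?_
      -- The target's own weight only helps, so the remaining decay is that of the travelling path.
      have h1 : (A ^ 2 * ε) ^ wtLT κ (n + 1) ≤ 1 := by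
        refine pow_le_one₀ (by positivity) ?_
        calc A ^ 2 * ε ≤ A ^ 4 * ε := by
              have := pow_le_pow_right₀ hA (show 2 ≤ 4 by norm_num)
              gcongr
          _ ≤ 1 := by linarith
      calc _ = C ^ (2 * N) * (A ^ 2) ^ wt μ * (C * A) * (A * ε) ^ n *
            (A ^ 2 * ε) ^ wtLT κ (n + 1) := by
            rw [← two_mul, pow_add, pow_add, mul_pow, mul_pow, pow_succ A n]; ring
        _ ≤ C ^ (2 * N) * (A ^ 2) ^ wt μ * (C * A) * (A * ε) ^ n * 1 := by gcongr
        _ = _ := by ring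
    calc ‖∑ κ ∈ box (N + 1) n, (c κ n).2‖ ≤ ∑ κ ∈ box (N + 1) n, K * (A * ε) ^ n :=
          norm_sum_le_of_le _ hterm
      _ = K * ((N + 2) * (A * ε)) ^ n := by
          rw [Finset.sum_const, card_box, nsmul_eq_mul, mul_pow (N + 2 : ℝ)]
          push_cast; ring
      _ ≤ _ := by gcongr
  have hlim1 : Filter.Tendsto (fun n => ∑ κ ∈ box (N + 1) n, stepWeight P lam u κ μ)
      Filter.atTop (nhds 1) := by
    have : Filter.Tendsto (fun n => 1 - ∑ κ ∈ box (N + 1) n, (c κ n).2) Filter.atTop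
        (nhds (1 - 0)) := hlim0.const_sub 1
    rw [sub_zero] at this
    refine this.congr' ?_
    filter_upwards [Filter.eventually_ge_atTop n₀] with n hn
    rw [← hone n]
    exact Finset.sum_congr rfl (hbox n hn)
  have hlim2 : Filter.Tendsto (fun n => ∑ κ ∈ box (N + 1) n, stepWeight P lam u κ μ)
      Filter.atTop (nhds (∑' κ, stepWeight P lam u κ μ)) := by
    classical
    have := tendsto_tsum_of_dominated_convergence (𝓕 := Filter.atTop)
      (f := fun n κ => if κ ∈ box (N + 1) n then stepWeight P lam u κ μ else 0)
      (g := fun κ => stepWeight P lam u κ μ) hsum.norm ?_ ?_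
    · refine this.congr fun n => ?_
      rw [tsum_eq_sum (s := box (N + 1) n) (fun κ hκ => if_neg hκ)]
      exact Finset.sum_congr rfl fun κ hκ => if_pos hκ
    · intro κ
      refine tendsto_const_nhds.congr' ?_
      filter_upwards [Filter.eventually_ge_atTop (κ.support.sup id)] with n hn
      split_ifs with hκ
      · rfl
      · by_contra h
        apply hκ
        have hs : κ 0 = 0 ∧ μ 0 = 0 ∧ len κ = len μ + 1 ∧ wt μ ≤ wt κ := by
          by_contra hs; exact h (stepWeight_eq_zero hs)
        refine mem_box.2 ⟨?_, fun i => ?_⟩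
        · rintro i (rfl | hi)
          · exact hs.1
          · by_contra h'
            have : id i ≤ κ.support.sup id :=
              Finset.le_sup (f := id) (Finsupp.mem_support_iff.2 h')
            simp only [id] at this
            omega
        · have := numLT_le_len κ (i + 1); rw [numLT_succ] at this; omega
    · refine Filter.Eventually.of_forall fun n κ => ?_
      split_ifs
      · exact le_rfl
      · rw [norm_zero]; exact norm_nonneg _
  have := hsum.hasSum
  rwa [tendsto_nhds_unique hlim2 hlim1] at this

/-! ### Several steps -/

theorem B_ne_zero {P : Params} {k : ℕ} {κ ν : Signature} {lam : ℂ} {u : Fin k → ℂ}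
    (h : B P k κ ν lam u ≠ 0) : len κ = len ν + k := by
  induction k generalizing κ lam with
  | zero =>
    rw [B] at h
    have : κ = ν := by by_contra h'; exact h (if_neg h')
    rw [this]; rfl
  | succ k ih =>
    rw [B] at h
    obtain ⟨τ, hτ⟩ : ∃ τ, Bone P κ τ lam (u 0) *
        B P k τ ν (lam + 2 * P.η) (fun j => u j.succ) ≠ 0 := by
      by_contra! h'
      exact h (finsum_eq_zero_of_forall_eq_zero h')
    have h1 := (Bone_ne_zero (left_ne_zero_of_mul hτ)).1
    have h2 := ih (right_ne_zero_of_mul hτ)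
    omega

theorem Bstoch_ne_zero {P : Params} {k : ℕ} {κ ν : Signature} {lam : ℂ} {u : Fin k → ℂ}
    (h : Bstoch P κ ν lam u ≠ 0) : κ 0 = 0 ∧ len κ = len ν + k := by
  rw [Bstoch, Bnorm] at h
  refine ⟨?_, B_ne_zero (right_ne_zero_of_mul (right_ne_zero_of_mul h))⟩
  by_contra h0
  apply h
  rw [Drho, if_neg h0]
  simp

/-- The sum is finite, since intermediate signatures have bounded length and weight. The
intermediate `Drho` cancels; it is nonzero because an empty column 0 in `κ` forces one in `τ`. -/
theorem hasSum_Bstoch_succ {P : Params} {k : ℕ} {κ ν : Signature} {lam : ℂ}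
    {u : Fin (k + 1) → ℂ} (hr : Regular P lam (len ν + k + 1)) :
    HasSum (fun τ => stepWeight P lam (u 0) κ τ *
      Bstoch P τ ν (lam + 2 * P.η) (fun j : Fin k => u j.succ)) (Bstoch P κ ν lam u) := by
  set s := (finite_len_wt (len κ) (wt κ)).toFinset
  have hs : ∀ τ, τ ∉ s → Bone P κ τ lam (u 0) = 0 := fun τ hτ => by
    by_contra h
    obtain ⟨h1, h2, -⟩ := Bone_ne_zero h
    exact hτ ((finite_len_wt _ _).mem_toFinset.2 ⟨by omega, h2⟩)
  have hB : B P (k + 1) κ ν lam u = ∑ τ ∈ s, Bone P κ τ lam (u 0) *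
      B P k τ ν (lam + 2 * P.η) (fun j => u j.succ) := by
    rw [B]
    refine finsum_eq_sum_of_support_subset _ fun τ hτ => ?_
    by_contra h
    exact left_ne_zero_of_mul (Function.mem_support.1 hτ) (hs τ h)
  have hE : Bstoch P κ ν lam u = ∑ τ ∈ s, stepWeight P lam (u 0) κ τ *
      Bstoch P τ ν (lam + 2 * P.η) (fun j : Fin k => u j.succ) := by
    rw [Bstoch, Bnorm, hB, Finset.mul_sum, Finset.mul_sum]
    refine Finset.sum_congr rfl fun τ _ => ?_
    by_cases h0 : κ 0 = 0
    swap
    · simp [stepWeight, Drho, h0]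
    by_cases h1 : Bone P κ τ lam (u 0) = 0
    · simp [stepWeight, h1]
    by_cases h2 : B P k τ ν (lam + 2 * P.η) (fun j => u j.succ) = 0
    · simp [Bstoch, Bnorm, h2]
    have hτ0 := (Bone_ne_zero h1).2.2 h0
    have hτl := B_ne_zero h2
    have hD : Drho P τ (lam + 2 * P.η) ≠ 0 :=
      Regular.Drho_ne (hτl ▸ hr.shift) hτ0
    have e1 : lam + 2 * P.η * ((k + 1 : ℕ) : ℂ) = lam + 2 * P.η + 2 * P.η * k := by
      push_cast; ring
    have e2 : ∏ i ∈ Finset.range (k + 1), f (lam + 2 * P.η * i) =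
        (∏ i ∈ Finset.range k, f (lam + 2 * P.η + 2 * P.η * i)) * f lam := by
      rw [Finset.prod_range_succ']
      congr 1
      · refine Finset.prod_congr rfl fun i _ => ?_
        congr 1; push_cast; ring
      · congr 1; push_cast; ring
    rw [stepWeight, Bstoch, Bnorm, e1, e2, Fin.prod_univ_succ]
    generalize Drho P τ (lam + 2 * P.η) = D at *
    have hη := hr.eta
    generalize f (2 * P.η) = E at *
    rw [pow_succ, pow_succ]
    generalize f (u 0 - P.q 0) / f (u 0 - P.p 0) = G
    generalize (∏ i : Fin k, f (u i.succ - P.q 0) / f (u i.succ - P.p 0)) = G'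
    have hd : Drho P κ lam / Drho P ν (lam + 2 * P.η + 2 * P.η * k) =
        (Drho P κ lam / D) * (D / Drho P ν (lam + 2 * P.η + 2 * P.η * k)) := by
      rw [div_mul_div_cancel₀ hD]
    rw [hd]
    generalize D / Drho P ν (lam + 2 * P.η + 2 * P.η * k) = X
    generalize Drho P κ lam / D = Y
    field_simp
  rw [hE]
  exact hasSum_sum_of_ne_finset_zero fun τ hτ => by simp [stepWeight, hs τ hτ]

theorem Controlled.shift {P : Params} {lam u : ℂ} {N : ℕ} {A ε : ℝ}
    (hc : Controlled P lam u (N + 1) A ε) : Controlled P (lam + 2 * P.η) u N A ε := by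
  refine ⟨hc.regular.shift, hc.eps_pos, hc.eps_le, hc.one_le, ?_, hc.compare, hc.small, hc.near⟩
  obtain ⟨C, h⟩ := hc.decay
  refine ⟨C, fun m hm i => ?_⟩
  have := h (m + 1) (by omega) i
  have e : lam + 2 * P.η * ((m + 1 : ℕ) - P.sumΛ i) =
      lam + 2 * P.η + 2 * P.η * (m - P.sumΛ i) := by push_cast; ring
  rwa [e] at this

/-- The pointwise bound is carried through the induction to give the joint summability needed for
exchanging sums. Each step multiplies the base by `A ^ 4` from `stepWeight_bound`, and by 2 to make
the intermediate sum converge. -/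
theorem hasSum_Bstoch {P : Params} {A ε : ℝ} (hA : 1 ≤ A) (hε : 0 < ε) {L : ℕ}
    (hL : (2 * A ^ 4) ^ L * ε ≤ 1 / 4) (hLN : (L + 2) * (A * ε) ≤ 1 / 2)
    {k : ℕ} {ν : Signature} (hν : ν 0 = 0) (hk : len ν + k ≤ L) {lam : ℂ} {u : Fin k → ℂ}
    (hr : Regular P lam (len ν + k))
    (hc : ∀ j, Controlled P lam (u j) (len ν + k) A ε) (hp : ∀ j, f (u j - P.p 0) ≠ 0) :
    HasSum (fun κ => Bstoch P κ ν lam u) 1 ∧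
      ∃ C : ℝ, 0 ≤ C ∧ ∀ κ, ‖Bstoch P κ ν lam u‖ ≤ C * ((2 * A ^ 4) ^ k) ^ wt κ * ε ^ wt κ := by
  induction k generalizing lam with
  | zero =>
    have hD : Drho P ν lam ≠ 0 := hr.Drho_ne hν
    have h1 : Bstoch P ν ν lam u = 1 := by
      simp [Bstoch, Bnorm, B, div_self hD]
    have h0 : ∀ κ, κ ≠ ν → Bstoch P κ ν lam u = 0 := fun κ hκ => by
      simp [Bstoch, Bnorm, B, hκ]
    refine ⟨?_, (ε ^ wt ν)⁻¹, by positivity, fun κ => ?_⟩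
    · have := hasSum_single (f := fun κ => Bstoch P κ ν lam u) ν h0
      rwa [h1] at this
    · by_cases h : κ = ν
      · rw [h, h1]
        simp [inv_mul_cancel₀ (pow_pos hε (wt ν)).ne']
      · rw [h0 κ h, norm_zero]; positivity
  | succ k ih =>
    have hA0 : 0 < A := by linarith
    have hR : 1 ≤ 2 * A ^ 4 := by have := one_le_pow₀ hA (n := 4); linarith
    obtain ⟨ih1, C, hC0, hC⟩ := ih (lam := lam + 2 * P.η) (u := fun j => u j.succ) (by omega)
      hr.shift (fun j => (hc j.succ).shift) (fun j => hp j.succ)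
    set N := len ν + k with hN
    have hc0 : Controlled P lam (u 0) (N + 1) A ε := hc 0
    obtain ⟨C₁, hC₁, hstep⟩ := hc0.stepWeight_bound (hp 0)
    have h4 : A ^ 4 * ε ≤ 1 / 4 := by
      refine le_trans ?_ hL
      gcongr
      calc A ^ 4 ≤ 2 * A ^ 4 := by have := pow_pos hA0 4; linarith
        _ ≤ _ := le_self_pow₀ hR (by omega)
    have hN2 : (N + 2) * (A * ε) ≤ 1 / 2 := by
      refine le_trans ?_ hLN
      gcongr
      omega
    have hRk : (2 * A ^ 4) ^ (k + 1) * ε ≤ 1 / 4 := by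
      refine le_trans ?_ hL
      gcongr
      omega
    set F : Signature → Signature → ℂ := fun τ κ => stepWeight P lam (u 0) κ τ *
      Bstoch P τ ν (lam + 2 * P.η) (fun j : Fin k => u j.succ) with hF
    have hFb : ∀ τ κ, ‖F τ κ‖ ≤ C₁ * C * ((2 * A ^ 4) ^ (k + 1) * ε) ^ wt κ *
        lenWeight N (1 / 2) τ := by
      intro τ κ
      have hpos : 0 ≤ C₁ * C * ((2 * A ^ 4) ^ (k + 1) * ε) ^ wt κ *
        lenWeight N (1 / 2) τ := mul_nonneg (by positivity) (lenWeight_nonneg _ (by norm_num) _)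
      by_cases hb : Bstoch P τ ν (lam + 2 * P.η) (fun j : Fin k => u j.succ) = 0
      · simpa [hF, hb] using hpos
      have hτ : len τ = N := (Bstoch_ne_zero hb).2
      by_cases hs : κ 0 = 0 ∧ τ 0 = 0 ∧ len κ = len τ + 1 ∧ wt τ ≤ wt κ
      swap
      · simpa [hF, stepWeight_eq_zero hs] using hpos
      rw [hF]
      simp only [norm_mul]
      rw [lenWeight, if_pos hτ]
      calc ‖stepWeight P lam (u 0) κ τ‖ * ‖Bstoch P τ ν (lam + 2 * P.η) fun j => u j.succ‖
          ≤ ‖stepWeight P lam (u 0) κ τ‖ * (C * ((2 * A ^ 4) ^ k) ^ wt τ * ε ^ wt τ) := by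
            gcongr
            exact hC τ
        _ = (‖stepWeight P lam (u 0) κ τ‖ * ε ^ wt τ) * (C * ((2 * A ^ 4) ^ k) ^ wt τ) := by ring
        _ ≤ (C₁ * (A ^ 4) ^ wt κ * ε ^ wt κ) * (C * ((2 * A ^ 4) ^ k) ^ wt κ) := by
            refine mul_le_mul (hstep κ τ hτ) ?_ (by positivity) (by positivity)
            exact mul_le_mul_of_nonneg_left
              (pow_le_pow_right₀ (one_le_pow₀ hR) hs.2.2.2) hC0
        _ = C₁ * C * ((2 * A ^ 4) ^ (k + 1) * ε) ^ wt κ * (1 / 2) ^ wt κ := by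
            rw [pow_succ (2 * A ^ 4) k, mul_pow _ ε, mul_pow _ (2 * A ^ 4),
              mul_pow (2 : ℝ) (A ^ 4)]
            -- The spare factor 2 is spent here: `(1/2) ^ wt κ ≤ (1/2) ^ wt τ` makes the bound
            -- summable over `τ`.
            have : (2 : ℝ) ^ wt κ * (1 / 2) ^ wt κ = 1 := by rw [← mul_pow]; norm_num
            linear_combination -(C₁ * C * ((2 * A ^ 4) ^ k) ^ wt κ * (A ^ 4) ^ wt κ * ε ^ wt κ) * this
        _ ≤ _ := by
            refine mul_le_mul_of_nonneg_left ?_ (by positivity)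
            exact pow_le_pow_of_le_one (by norm_num) (by norm_num) hs.2.2.2
    have hsumF : Summable fun x : Signature × Signature => F x.1 x.2 := by
      have hg : Summable fun x : Signature × Signature =>
          C₁ * C * (lenWeight N (1 / 2) x.1 * lenWeight (N + 1) (1 / 4) x.2) :=
        ((summable_lenWeight N (by norm_num) (by norm_num)).mul_of_nonneg
          (summable_lenWeight (N + 1) (by norm_num) (by norm_num))
          (lenWeight_nonneg _ (by norm_num)) (lenWeight_nonneg _ (by norm_num))).mul_left _
      refine Summable.of_norm_bounded hg fun ⟨τ, κ⟩ => ?_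
      have h0 := lenWeight_nonneg N (t := 1 / 2) (by norm_num) τ
      by_cases hz : F τ κ = 0
      · simp only [hz, norm_zero]
        have := lenWeight_nonneg (N + 1) (t := 1 / 4) (by norm_num) κ
        positivity
      have hτ : len τ = N := (Bstoch_ne_zero (right_ne_zero_of_mul hz)).2
      have hκ : len κ = N + 1 := by
        by_contra h
        exact left_ne_zero_of_mul hz (stepWeight_eq_zero (by omega))
      refine (hFb τ κ).trans ?_
      rw [lenWeight, lenWeight, if_pos hκ, if_pos hτ]
      calc _ ≤ C₁ * C * (1 / 4) ^ wt κ * (1 / 2) ^ wt τ := by gcongr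
        _ = _ := by ring
    obtain ⟨T, hT⟩ := hsumF
    -- Summing first over `κ` uses the one-step identity, then the induction hypothesis; summing
    -- first over `τ` below recovers `Bstoch`.
    have hT1 : T = 1 := by
      have h1 : ∀ τ, HasSum (fun κ => F τ κ)
          (Bstoch P τ ν (lam + 2 * P.η) (fun j : Fin k => u j.succ)) := by
        intro τ
        by_cases hb : Bstoch P τ ν (lam + 2 * P.η) (fun j : Fin k => u j.succ) = 0
        · simp only [hF, hb, mul_zero]; exact hasSum_zero
        obtain ⟨hτ0, hτ⟩ := Bstoch_ne_zero hb
        have := (hc0.hasSum_stepWeight (hp 0) h4 hN2 hτ hτ0).mul_right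
          (Bstoch P τ ν (lam + 2 * P.η) (fun j : Fin k => u j.succ))
        rwa [one_mul] at this
      exact (hT.prod_fiberwise h1).unique ih1
    subst hT1
    have h2 : ∀ κ, HasSum (fun τ => F τ κ) (Bstoch P κ ν lam u) := fun κ =>
      hasSum_Bstoch_succ hr
    constructor
    · have hT' := (Equiv.prodComm Signature Signature).hasSum_iff.2 hT
      exact hT'.prod_fiberwise h2
    · refine ⟨C₁ * C * ∑' τ, lenWeight N (1 / 2) τ, mul_nonneg (by positivity)
        (tsum_nonneg (lenWeight_nonneg _ (by norm_num))), fun κ => ?_⟩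
      have hs := (summable_lenWeight N (t := 1 / 2) (by norm_num) (by norm_num)).hasSum.mul_left
        (C₁ * C * ((2 * A ^ 4) ^ (k + 1) * ε) ^ wt κ)
      have := tsum_of_norm_bounded hs (fun τ => hFb τ κ)
      rw [(h2 κ).tsum_eq] at this
      refine this.trans (le_of_eq ?_)
      rw [mul_pow]; ring

theorem B_eq_zero_of_f_eq_zero {P : Params} {k : ℕ} {κ ν : Signature} {lam : ℂ}
    {u : Fin k → ℂ} (hκ : κ 0 = 0) {j : Fin k} (hj : f (u j - P.p 0) = 0) :
    B P k κ ν lam u = 0 := by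
  induction k generalizing κ lam with
  | zero => exact j.elim0
  | succ k ih =>
    rw [B]
    refine finsum_eq_zero_of_forall_eq_zero fun τ => ?_
    by_cases h1 : Bone P κ τ lam (u 0) = 0
    · rw [h1, zero_mul]
    refine Fin.cases (fun hj => absurd (Bone_eq_zero_of_f_eq_zero hκ hj) h1) (fun i hj => ?_) j hj
    rw [ih (u := fun j => u j.succ) ((Bone_ne_zero h1).2.2 hκ) hj, mul_zero]

theorem Drho_zero (P : Params) (lam : ℂ) : Drho P 0 lam = 1 := by
  simp [Drho, cNorm, len]

theorem controlled_of_nonResonant {P : Params} {lam u : ℂ} {L : ℕ} {a A ε θ : ℝ} (ha : 0 < a)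
    (hA : 1 ≤ A) (haA : a⁻¹ ≤ A) (hε : 0 < ε) (hε1 : ε ≤ 1) (hη : f (2 * P.η) ≠ 0)
    (hadm : Admissible P L) (hnr : NonResonant P L a lam) (hθ : 0 < θ)
    (h : ∀ i, θ * growth (P.q i - P.p i) ≤ ‖f (P.q i - u)‖ ∧
      ‖f (P.p i - u)‖ * growth (P.q i - P.p i) ≤ ε * ‖f (P.q i - u)‖ ∧ growth (P.p i - u) ≤ 2) :
    Controlled P lam u L A ε := by
  obtain ⟨c, hc, hres⟩ := hnr
  refine ⟨⟨hη, fun i m hm => ?_, fun i j hj => hadm.f_ne_zero i hj⟩, hε, hε1, hA,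
    ⟨2 + 1 / c, fun m hm i => ?_⟩, ⟨θ, hθ, fun i => (h i).1⟩, fun i => (h i).2.1,
    fun i => (h i).2.2⟩
  · exact norm_pos_iff.1 (lt_of_lt_of_le (by positivity) (hres m hm i))
  · refine (growth_le_mul_of_le (by positivity) (hres m hm i)).trans ?_
    gcongr
    have h1 : 1 ≤ A ^ i := one_le_pow₀ hA
    have h2 : 1 / (c * a ^ i) ≤ 1 / c * A ^ i := by
      calc 1 / (c * a ^ i) = 1 / c * (a⁻¹) ^ i := by
            rw [inv_pow, ← div_div, div_eq_mul_inv (1 / c)]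
        _ ≤ _ := by gcongr
    rw [add_mul]
    linarith

end TrigIRF

end

/-! ### Choice of the constants and conclusion -/

theorem mainTheorem11 (L : ℕ) (hL : 1 ≤ L) (a d : ℝ) (ha : 0 < a) (hd : 0 < d) :
    ∃ δ : ℝ, 0 < δ ∧ ∀ (P : Params) (lam : ℂ),
      f (2 * P.η) ≠ 0 → Admissible P L → (∀ i, d ≤ ‖f (P.q i - P.p i)‖) → NonResonant P L a lam →
      (∀ u : Fin L → ℂ, (∀ j i, ‖u j - P.p i‖ < δ) →
        HasSum (fun κ : Signature => Drho P κ lam * Bnorm P κ 0 lam u)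
          ((-f (2 * P.η)) ^ L * ∏ j, f (u j - P.p 0) / f (u j - P.q 0))) ∧
      (∀ (k : ℕ) (ν : Signature), 1 ≤ k → ν 0 = 0 → len ν + k = L →
        ∀ u : Fin k → ℂ, (∀ j i, ‖u j - P.p i‖ < δ) → (∀ j, f (u j - P.p 0) ≠ 0) →
        HasSum (fun κ : {κ : Signature // κ 0 = 0} => Bstoch P κ.1 ν lam u) 1) := by
  set A : ℝ := max 1 a⁻¹
  have hA : 1 ≤ A := le_max_left _ _
  have hA0 : 0 < A := by linarith
  have hA4 : A ≤ A ^ 4 := le_self_pow₀ hA (by norm_num)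
  have hR : 1 ≤ 2 * A ^ 4 := by linarith
  -- `(2A⁴)^L` keeps the `L`-step bounds geometric, and `L + 2` beats the count of configurations
  -- per column.
  set ε : ℝ := 1 / (4 * (L + 2) * (2 * A ^ 4) ^ L) with hεd
  have hε : 0 < ε := by positivity
  have hRL : 1 ≤ (2 * A ^ 4) ^ L := one_le_pow₀ hR
  have hεL : (2 * A ^ 4) ^ L * ε ≤ 1 / 4 := by
    rw [hεd, mul_one_div, div_le_div_iff₀ (by positivity) (by norm_num)]
    have : (0 : ℝ) ≤ L := Nat.cast_nonneg L
    nlinarith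
  have hε1 : ε ≤ 1 := by nlinarith
  have hεN : (L + 2) * (A * ε) ≤ 1 / 2 := by
    have h1 : A ≤ (2 * A ^ 4) ^ L := by
      refine le_trans ?_ (le_self_pow₀ hR (by omega))
      linarith
    rw [hεd, ← mul_assoc, mul_one_div, div_le_div_iff₀ (by positivity) (by norm_num)]
    have : (0 : ℝ) ≤ L := Nat.cast_nonneg L
    nlinarith [mul_le_mul_of_nonneg_left h1 (show (0 : ℝ) ≤ L + 2 by positivity)]
  obtain ⟨δ, hδ, θ, hθ, hsmall⟩ := exists_small_radius hd hε
  refine ⟨δ, hδ, fun P lam hη hadm hqp hnr => ?_⟩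
  have hctrl : ∀ u : ℂ, (∀ i, ‖u - P.p i‖ < δ) → Controlled P lam u L A ε := fun u hu =>
    controlled_of_nonResonant ha hA (le_max_right _ _) hε hε1 hη hadm hnr hθ fun i => by
      have := hsmall (P.p i - u) (P.q i - P.p i) (by rw [norm_sub_rev]; exact hu i) (hqp i)
      rwa [sub_add_sub_cancel] at this
  have hmain : ∀ (k : ℕ) (ν : Signature), 1 ≤ k → ν 0 = 0 → len ν + k = L →
      ∀ u : Fin k → ℂ, (∀ j i, ‖u j - P.p i‖ < δ) → (∀ j, f (u j - P.p 0) ≠ 0) →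
      HasSum (fun κ : Signature => Bstoch P κ ν lam u) 1 := by
    intro k ν hk hν hlen u hu hp
    have hc : ∀ j, Controlled P lam (u j) (len ν + k) A ε := fun j => hlen ▸ hctrl (u j) (hu j)
    exact (hasSum_Bstoch hA hε hεL hεN hν hlen.le (hc ⟨0, hk⟩).regular hc hp).1
  refine ⟨fun u hu => ?_, fun k ν hk hν hlen u hu hp => ?_⟩
  · by_cases hp : ∀ j, f (u j - P.p 0) ≠ 0
    · have h := (hmain L 0 hL rfl (by simp [len]) u hu hp).mul_left
        ((-f (2 * P.η)) ^ L * ∏ j, f (u j - P.p 0) / f (u j - P.q 0))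
      rw [mul_one] at h
      refine h.congr_fun fun κ => ?_
      have hq : ∀ j, f (u j - P.q 0) ≠ 0 := fun j => by
        have := (hctrl (u j) (hu j)).q_ne 0
        rw [← neg_sub, f_neg]
        exact neg_ne_zero.2 this
      have hprod : (∏ j, f (u j - P.p 0) / f (u j - P.q 0)) *
          (∏ j, f (u j - P.q 0) / f (u j - P.p 0)) = 1 := by
        rw [← Finset.prod_mul_distrib]
        refine Finset.prod_eq_one fun j _ => ?_
        rw [div_mul_div_cancel₀ (hq j), div_self (hp j)]
      have hsign : (-f (2 * P.η)) ^ L * ((-1) ^ L / f (2 * P.η) ^ L) = 1 := by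
        rw [← div_pow, ← mul_pow]
        have : -f (2 * P.η) * (-1 / f (2 * P.η)) = 1 := by field_simp
        rw [this, one_pow]
      rw [Bstoch, Drho_zero, div_one]
      linear_combination (-(Drho P κ lam * Bnorm P κ 0 lam u)) * (hsign +
        (-f (2 * P.η)) ^ L * ((-1) ^ L / f (2 * P.η) ^ L) * (hprod))
    -- Here `Bstoch` is unavailable, but every term vanishes: either `κ` has a zero part, or the row
    -- with parameter `u_j` cannot cross column 0.
    · push Not at hp
      obtain ⟨j, hj⟩ := hp
      have h0 : ∏ j, f (u j - P.p 0) / f (u j - P.q 0) = 0 :=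
        Finset.prod_eq_zero (Finset.mem_univ j) (by rw [hj, zero_div])
      rw [h0, mul_zero]
      refine hasSum_zero.congr_fun fun κ => ?_
      by_cases hκ : κ 0 = 0
      · rw [Bnorm, B_eq_zero_of_f_eq_zero hκ hj, mul_zero, mul_zero]
      · rw [Drho, if_neg hκ, zero_mul]
  · refine (hasSum_subtype_iff_of_support_subset (s := {κ : Signature | κ 0 = 0})
      fun κ hκ => ?_).2 (hmain k ν hk hν hlen u hu hp)
    exact (Bstoch_ne_zero hκ).1
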